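/- **Setting.** For $d\in\{1,2\}$ let $\Gamma_{\mathbb R^d}$ be the space of locally finite counting measures on $\mathbb R^d$ (with the Borel $\sigma$-algebra of the vague topology), $\Gamma=\Gamma_{\mathbb R}$, with shifts $\theta_x\xi(A)=\xi(A+x)$, and $\Lambda_1=[-\tfrac12,\tfrac12]$. For a measure $\mathsf Q$ on $\Gamma_{\mathbb R^d}$ that is invariant under all $\theta_x$, $x\in\mathbb R^d$, its Palm measure is $$\mathsf Q^0(A)=\int\int_{\Lambda_1^d}\mathbf 1_A(\theta_x\xi)\,\xi(dx)\,\mathsf Q(d\xi).$$ Let $\mathcal P_{s,1}(\Gamma)$ be the set of shift-invariant probability measures $\mathsf P$ on $\Gamma$ with $\int\xi(\Lambda_1)\,\mathsf P(d\xi)=1$ under which $\xi$ is a.s. simple, i.e. $\xi(\{x\})\in\{0,1\}$ for all $x$. Number the points of a configuration $\xi$ on $\mathbb R$ as $(\tau_i)_{i\in\mathbb Z}$ with $\tau_i\le\tau_{i+1}$ and $\tau_0\le 0<\tau_1$, let $\mathsf{sq}(\xi)=(\tau_i-\tau_{i-1})_{i\in\mathbb Z}\in\mathsf S=[0,\infty)^{\mathbb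 Z}$, and let $\mathsf j(\mathsf P)=\mathsf{sq}_\#\mathsf P^0$ be the gap distribution of $\mathsf P$. For probability measures $\Pi_0,\Pi_1$ on $\mathsf S$, $\mathsf{Cpl}_s(\Pi_0,\Pi_1)$ is the set of couplings of $\Pi_0,\Pi_1$ that are invariant under the diagonal shifts $(s_i,s'_i)_i\mapsto(s_{i+k},s'_{i+k})_i$, $k\in\mathbb Z$. For $\mathsf P_0,\mathsf P_1\in\mathcal P_{s,1}(\Gamma)$, $\mathsf{Cpl}_{s,m}(\mathsf P_0,\mathsf P_1)$ is the set of $\sigma$-finite measures $\mathsf Q$ on $\Gamma_{\mathbb R^2}$, invariant under all shifts $\theta_x$, $x\in\mathbb R^2$, that do not charge the empty configuration, are concentrated on monotone configurations (if $(x_1,y_1),(x_2,y_2)\in\bar\xi$ and $x_1\le x_2$, then $y_1\le y_2$), and whose Palm measure $\mathsf Q^0$ is a probability measure with $(\mathrm{Pr}_i)_\#\mathsf Q^0=\mathsf P_i^0$, $i=0,1$. Here $\mathrm{Pr}_i\bar\xi$ is the image of the counting measure $\bar\xi$ under the projection to the $i$-th coordinate (points are counted with multiplicity). Number the points of a monotone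 $\bar\xi$ as $(\bar\tau_\ell)_{\ell\in\mathbb Z}$, increasing in both coordinates, with the first coordinate of $\bar\tau_0$ at most $0$ and that of $\bar\tau_1$ positive; for $(x,y)=\bar\tau_\ell$ put $(x^+,y^+)=\bar\tau_{\ell+1}$. For $1\le p<\infty$ let $$\mathscr W_p^p(\mathsf P_0,\mathsf P_1)=\inf_{\mathsf Q\in\mathsf{Cpl}_{s,m}(\mathsf P_0,\mathsf P_1)}\int\sum_{(x,y)\in\bar\xi\cap\Lambda_1^2}|(x^+-x)-(y^+-y)|^p\,\mathsf Q(d\bar\xi),\qquad \mathscr W_{gap,p}^p(\Pi_0,\Pi_1)=\inf_{\mathsf U\in\mathsf{Cpl}_s(\Pi_0,\Pi_1)}\int|s_1-s_1'|^p\,\mathsf U(ds,ds'),$$ with values in $[0,\infty]$. **Theorem.** Let $\mathsf P_0,\mathsf P_1\in\mathcal P_{s,1}(\Gamma)$. The map $$\iota:\mathsf{Cpl}_{s,m}(\mathsf P_0,\mathsf P_1)\to\mathsf{Cpl}_s(\mathsf j(\mathsf P_0),\mathsf j(\mathsf P_1)),\qquad \mathsf Q\mapsto(\mathsf{sq}\circ\mathrm{Pr}_0,\mathsf{sq}\circ\mathrm{Pr}_1)_\#\mathsf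 Q^0,$$ is well defined and a bijection. Moreover, for every $1\le p<\infty$ and every $\mathsf Q\in\mathsf{Cpl}_{s,m}(\mathsf P_0,\mathsf P_1)$, $$\int\sum_{(x,y)\in\bar\xi\cap\Lambda_1^2}|(x^+-x)-(y^+-y)|^p\,\mathsf Q(d\bar\xi)=\int|s_1-s_1'|^p\,\iota(\mathsf Q)(ds,ds')\in[0,\infty].$$ In particular $\mathscr W_p(\mathsf P_0,\mathsf P_1)=\mathscr W_{gap,p}(\mathsf j(\mathsf P_0),\mathsf j(\mathsf P_1))$, and there exists a $\mathscr W_p$-optimal $\mathsf Q\in\mathsf{Cpl}_{s,m}(\mathsf P_0,\mathsf P_1)$, i.e. one attaining the infimum in the definition of $\mathscr W_p^p(\mathsf P_0,\mathsf P_1)$. -/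

import Mathlib

open MeasureTheory ProbabilityTheory Set
open scoped ENNReal NNReal

noncomputable section

namespace PointProcess

/-- Locally finite counting measures: integer valued on bounded Borel sets. -/
def IsCounting {E : Type*} [PseudoMetricSpace E] [MeasurableSpace E] (μ : Measure E) : Prop :=
  ∀ A : Set E, MeasurableSet A → Bornology.IsBounded A → ∃ n : ℕ, μ A = n

/-- The configuration space of locally finite counting measures (points may have multiplicities).
Its `σ`-algebra is the one generated by the evaluations `ξ ↦ ξ A`, that is, the Borel `σ`-algebra
of the vague topology. -/
abbrev Config (E : Type*) [PseudoMetricSpace E] [MeasurableSpace E] : Type _ :=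
  {μ : Measure E // IsCounting μ}

section General

variable {E : Type*} [NormedAddCommGroup E] [MeasureSpace E] [BorelSpace E]
  [SecondCountableTopology E]

theorem IsCounting.map_sub {μ : Measure E} (h : IsCounting μ) (x : E) :
    IsCounting (μ.map (fun y => y - x)) := by
  intro A hA hb
  have hm : Measurable (fun y : E => y - x) := measurable_id.sub_const x
  rw [Measure.map_apply hm hA]
  refine h _ (hm hA) ?_
  obtain ⟨R, hR⟩ := hb.exists_norm_le
  refine isBounded_iff_forall_norm_le.2 ⟨R + ‖x‖, fun y hy => ?_⟩
  calc ‖y‖ = ‖(y - x) + x‖ := by rw [sub_add_cancel]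
    _ ≤ ‖y - x‖ + ‖x‖ := norm_add_le _ _
    _ ≤ R + ‖x‖ := by gcongr; exact hR _ hy

/-- The shift `θ_x`, given by `(θ_x ξ)(A) = ξ(A + x)`. -/
def shift (x : E) (ξ : Config E) : Config E :=
  ⟨ξ.1.map (fun y => y - x), ξ.2.map_sub x⟩

/-- Invariance under all shifts `θ_x`. -/
def Stationary (Q : Measure (Config E)) : Prop :=
  ∀ x : E, Q.map (shift x) = Q

/-- The evaluation kernel `ξ ↦ ξ`. -/
def evalKernel (E : Type*) [PseudoMetricSpace E] [MeasurableSpace E] : Kernel (Config E) E :=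
  ⟨Subtype.val, measurable_subtype_coe⟩

instance : IsSFiniteKernel (evalKernel E) := by
  let D : ℕ → Set E := disjointed (fun n : ℕ => Metric.ball (0 : E) n)
  have hDm : ∀ n, MeasurableSet (D n) := fun n =>
    MeasurableSet.disjointed (fun _ => Metric.isOpen_ball.measurableSet) n
  have hDb : ∀ n, Bornology.IsBounded (D n) := fun n =>
    Metric.isBounded_ball.subset (disjointed_subset _ n)
  have hDd : Pairwise (Function.onFun Disjoint D) := disjoint_disjointed _
  have hDu : ⋃ n, D n = univ := by
    rw [iUnion_disjointed]; exact Metric.iUnion_ball_nat 0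
  have hs : ∀ n m : ℕ, MeasurableSet {ξ : Config E | ξ.1 (D n) = m} := fun n m =>
    ((Measure.measurable_coe (hDm n)).comp measurable_subtype_coe) (measurableSet_singleton _)
  classical
  let k : ℕ × ℕ → Kernel (Config E) E := fun i =>
    Kernel.piecewise (hs i.1 i.2) ((evalKernel E).restrict (hDm i.1)) 0
  have hk : ∀ i, IsSFiniteKernel (k i) := fun i => by
    have : IsFiniteKernel (k i) := by
      refine ⟨⟨i.2, ENNReal.natCast_lt_top _, fun ξ => ?_⟩⟩
      simp only [k, Kernel.piecewise_apply]
      split_ifs with h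
      · rw [Kernel.restrict_apply, Measure.restrict_apply_univ]
        exact le_of_eq h
      · simp
    infer_instance
  have : evalKernel E = Kernel.sum k := by
    refine Kernel.ext fun ξ => Measure.ext fun A hA => ?_
    rw [Kernel.sum_apply' _ _ hA, ENNReal.tsum_prod']
    have h1 : ∀ n, ∑' m, k (n, m) ξ A = ξ.1 (A ∩ D n) := fun n => by
      obtain ⟨m, hm⟩ := ξ.2 (D n) (hDm n) (hDb n)
      rw [tsum_eq_single m]
      · simp only [k, Kernel.piecewise_apply]
        rw [if_pos (show ξ ∈ {ξ : Config E | ξ.1 (D n) = m} from hm), Kernel.restrict_apply,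
          Measure.restrict_apply hA]
        rfl
      · intro m' hm'
        simp only [k, Kernel.piecewise_apply]
        rw [if_neg]
        · simp
        · intro h
          have h' : ξ.1 (D n) = m' := h
          rw [hm] at h'
          exact hm' (by exact_mod_cast h'.symm)
    simp_rw [h1]
    rw [← measure_iUnion (fun i j hij => (hDd hij).mono inter_subset_right inter_subset_right)
      (fun n => hA.inter (hDm n)), ← inter_iUnion, hDu, inter_univ]
    rfl
  rw [this]
  infer_instance

theorem measurable_shift : Measurable (fun p : Config E × E => shift p.2 p.1) := by
  refine Measurable.subtype_mk (Measure.measurable_of_measurable_coe _ fun C hC => ?_)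
  have : (fun p : Config E × E => (p.1.1.map (fun y => y - p.2)) C) =
      fun p => ∫⁻ y, C.indicator 1 (y - p.2)
        ∂(((evalKernel E).comap Prod.fst measurable_fst : Kernel (Config E × E) E) p) := by
    funext p
    have hm : Measurable (fun y : E => y - p.2) := measurable_id.sub_const _
    rw [Measure.map_apply hm hC, Kernel.comap_apply, ← lintegral_indicator_one (hm hC)]
    rfl
  rw [this]
  refine Measurable.lintegral_kernel_prod_right
    (f := fun (p : Config E × E) (y : E) => C.indicator (1 : E → ℝ≥0∞) (y - p.2)) ?_
  exact (measurable_one.indicator hC).comp (measurable_snd.sub measurable_fst.snd)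

theorem measurable_palm_integrand {B : Set E} (hB : MeasurableSet B) {A : Set (Config E)}
    (hA : MeasurableSet A) :
    Measurable (fun ξ : Config E => ∫⁻ x in B, A.indicator 1 (shift x ξ) ∂ξ.1) := by
  have : (fun ξ : Config E => ∫⁻ x in B, A.indicator 1 (shift x ξ) ∂ξ.1) =
      fun ξ => ∫⁻ x, A.indicator (1 : Config E → ℝ≥0∞) (shift x ξ)
        ∂((evalKernel E).restrict hB ξ) := by
    funext ξ
    rw [Kernel.restrict_apply]
    rfl
  rw [this]
  exact Measurable.lintegral_kernel_prod_right
    (f := fun (ξ : Config E) (x : E) => A.indicator (1 : Config E → ℝ≥0∞) (shift x ξ))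
    ((measurable_one.indicator hA).comp measurable_shift)

/-- The Palm measure, computed with the window `B`:
`Q⁰(A) = Leb(B)⁻¹ ∫ ∫_B 1_A(θ_x ξ) ξ(dx) Q(dξ)`. -/
def palm (B : Set E) (hB : MeasurableSet B) (Q : Measure (Config E)) : Measure (Config E) :=
  Measure.ofMeasurable
    (fun A _ => (volume B)⁻¹ * ∫⁻ ξ, ∫⁻ x in B, A.indicator 1 (shift x ξ) ∂ξ.1 ∂Q)
    (by simp)
    (by
      intro A hA hd
      rw [ENNReal.tsum_mul_left, ← lintegral_tsum
        (fun i => (measurable_palm_integrand hB (hA i)).aemeasurable)]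
      congr 1
      refine lintegral_congr fun ξ => ?_
      rw [← lintegral_tsum]
      · refine lintegral_congr fun x => ?_
        have := measure_iUnion (μ := Measure.dirac (shift x ξ)) hd hA
        simpa only [Measure.dirac_apply' _ (MeasurableSet.iUnion hA),
          Measure.dirac_apply' _ (hA _)] using this
      · exact fun i => (((measurable_one.indicator (hA i)).comp measurable_shift).comp
          (measurable_const.prodMk measurable_id)).aemeasurable)

end General

/-- `Λ₁ = [-1/2, 1/2]`. -/
def window : Set ℝ := Icc (-(1 / 2)) (1 / 2)

theorem measurableSet_window : MeasurableSet window := measurableSet_Icc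

/-- The Palm measure of a measure on configurations on the line. -/
def palmLine (P : Measure (Config ℝ)) : Measure (Config ℝ) :=
  palm window measurableSet_window P

/-- The Palm measure of a measure on configurations in the plane. -/
def palmPlane (Q : Measure (Config (ℝ × ℝ))) : Measure (Config (ℝ × ℝ)) :=
  palm (window ×ˢ window) (measurableSet_window.prod measurableSet_window) Q

/-- Laws of simple stationary point processes on the line of intensity one. -/
structure IsStationaryUnit (P : Measure (Config ℝ)) : Prop where
  prob : IsProbabilityMeasure P
  stationary : Stationary P
  intensity : ∫⁻ ξ, ξ.1 window ∂P = 1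
  simple : ∀ᵐ ξ ∂P, ∀ x : ℝ, ξ.1 {x} = 0 ∨ ξ.1 {x} = 1

/-! ### Numbering of the points, gaps -/

/-- `t` lists the points of `μ` (with multiplicity) in increasing order, numbered such that
`π (t 0) ≤ 0 < π (t 1)`. -/
def IsNumbering {E : Type*} [Preorder E] [MeasurableSpace E] (π : E → ℝ) (μ : Measure E)
    (t : ℤ → E) : Prop :=
  Monotone t ∧ π (t 0) ≤ 0 ∧ 0 < π (t 1) ∧ μ = Measure.sum (fun i => Measure.dirac (t i))

open Classical in
/-- The numbering of the points of `μ` (constantly `0` when there is none). -/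
def numbering {E : Type*} [Preorder E] [Zero E] [MeasurableSpace E] (π : E → ℝ)
    (μ : Measure E) : ℤ → E :=
  if h : ∃ t, IsNumbering π μ t then h.choose else 0

/-- The points `τ_i` of a configuration on the line: `τ_0 ≤ 0 < τ_1`, `τ_i ≤ τ_{i+1}`. -/
def tau (μ : Measure ℝ) : ℤ → ℝ := numbering id μ

/-- The points of a monotone configuration in the plane, increasing in both coordinates, with
`pr₀ (τ̄_0) ≤ 0 < pr₀ (τ̄_1)`. -/
def tauBar (μ : Measure (ℝ × ℝ)) : ℤ → ℝ × ℝ := numbering Prod.fst μ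

/-- The space `[0,∞)^ℤ` of sequences of gaps, with its product `σ`-algebra. -/
abbrev GapSeq : Type := ℤ → ℝ≥0

/-- The gaps `τ_i - τ_{i-1}` (these differences are never negative). -/
def sq (μ : Measure ℝ) : GapSeq := fun i => (tau μ i - tau μ (i - 1)).toNNReal

/-- The shift `σ^k` of sequences. -/
def seqShift (k : ℤ) (s : GapSeq) : GapSeq := fun i => s (i + k)

/-- The gap distribution `j(P)`, the law of the gaps under the Palm measure. -/
def gapLaw (P : Measure (Config ℝ)) : Measure GapSeq :=
  (palmLine P).map (fun ξ => sq ξ.1)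

/-- Stationary couplings of two gap distributions. -/
structure IsGapCoupling (G₀ G₁ : Measure GapSeq) (U : Measure (GapSeq × GapSeq)) : Prop where
  prob : IsProbabilityMeasure U
  fst : U.map Prod.fst = G₀
  snd : U.map Prod.snd = G₁
  stationary : ∀ k : ℤ, U.map (Prod.map (seqShift k) (seqShift k)) = U

/-- `Cpl_s(G₀, G₁)`. -/
def gapCouplings (G₀ G₁ : Measure GapSeq) : Set (Measure (GapSeq × GapSeq)) :=
  {U | IsGapCoupling G₀ G₁ U}

/-- Monotone configurations in the plane; `p` is a point of `ξ` iff `ξ {p} ≠ 0`. -/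
def MonotoneConfig (ξ : Config (ℝ × ℝ)) : Prop :=
  ∀ p q : ℝ × ℝ, ξ.1 {p} ≠ 0 → ξ.1 {q} ≠ 0 → p.1 ≤ q.1 → p.2 ≤ q.2

/-- Projection of a planar configuration to the first coordinate, points counted with
multiplicity. The result is a measure on the line that need not be locally finite. -/
def proj₀ (ξ : Config (ℝ × ℝ)) : Measure ℝ := ξ.1.map Prod.fst

/-- Projection of a planar configuration to the second coordinate. -/
def proj₁ (ξ : Config (ℝ × ℝ)) : Measure ℝ := ξ.1.map Prod.snd

/-- Stationary monotone couplings of two point processes. -/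
structure IsMonotoneCoupling (P₀ P₁ : Measure (Config ℝ)) (Q : Measure (Config (ℝ × ℝ))) :
    Prop where
  sigmaFinite : SigmaFinite Q
  stationary : Stationary Q
  nonempty : ∀ᵐ ξ ∂Q, ξ.1 ≠ 0
  palm_prob : IsProbabilityMeasure (palmPlane Q)
  palm_fst : (palmPlane Q).map proj₀ = (palmLine P₀).map Subtype.val
  palm_snd : (palmPlane Q).map proj₁ = (palmLine P₁).map Subtype.val
  monotone : ∀ᵐ ξ ∂Q, MonotoneConfig ξ

/-- `Cpl_{s,m}(P₀, P₁)`. -/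
def monotoneCouplings (P₀ P₁ : Measure (Config ℝ)) : Set (Measure (Config (ℝ × ℝ))) :=
  {Q | IsMonotoneCoupling P₀ P₁ Q}

/-- The map `ι : Q ↦ (sq ∘ Pr₀, sq ∘ Pr₁)_# Q⁰`. -/
def iota (Q : Measure (Config (ℝ × ℝ))) : Measure (GapSeq × GapSeq) :=
  (palmPlane Q).map (fun ξ => (sq (proj₀ ξ), sq (proj₁ ξ)))

/-- `∫ |s_1 - s'_1|^p U(ds, ds')`. -/
def gapCost (p : ℝ) (U : Measure (GapSeq × GapSeq)) : ℝ≥0∞ :=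
  ∫⁻ u, ENNReal.ofReal (|(u.1 1 : ℝ) - (u.2 1 : ℝ)| ^ p) ∂U

open Classical in
/-- `∫ ∑_{(x,y) ∈ ξ ∩ Λ₁²} |(x⁺ - x) - (y⁺ - y)|^p Q(dξ)`, where `(x⁺, y⁺) = τ̄_{l+1}(ξ)` if
`(x, y) = τ̄_l(ξ)`. -/
def cost (p : ℝ) (Q : Measure (Config (ℝ × ℝ))) : ℝ≥0∞ :=
  ∫⁻ ξ, ∑' l : ℤ,
    if tauBar ξ.1 l ∈ window ×ˢ window then
      ENNReal.ofReal (|((tauBar ξ.1 (l + 1)).1 - (tauBar ξ.1 l).1)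
        - ((tauBar ξ.1 (l + 1)).2 - (tauBar ξ.1 l).2)| ^ p)
    else 0 ∂Q

/-- The extended metric between gap distributions. -/
def gapDist (p : ℝ) (G₀ G₁ : Measure GapSeq) : ℝ≥0∞ :=
  (⨅ U ∈ gapCouplings G₀ G₁, gapCost p U) ^ (1 / p)

/-- The extended metric between point processes. -/
def processDist (p : ℝ) (P₀ P₁ : Measure (Config ℝ)) : ℝ≥0∞ :=
  (⨅ Q ∈ monotoneCouplings P₀ P₁, cost p Q) ^ (1 / p)

end PointProcess

end

/-!
Let `V` be the Palm measure of a stationary measure `Q` on configurations. The refined Campbell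
formula `∫ ∑_{x ∈ ξ} F (θ_x ξ, x) Q(dξ) = ∫ ∫ F (ξ, x) dx V(dξ)` (`HasPalm`, `hasPalm_palm`)
identifies stationary measures that do not charge the empty configuration with measures `V` that
are invariant under changes of the root (`IsPointStationary`). Indeed, if weights `W (θ_x ξ, x)`
sum to one over the points of almost every `ξ`, then inserting them into the formula expresses `Q`
through `V` (`HasPalm.unique`), and conversely this expression defines a stationary measure with
Palm measure `V` (`hasPalm_palmInverse`, `stationary_palmInverse`).

Under `V` the origin is a point of the configuration. If the points can be listed in strictly
increasing order, unboundedly in both directions, the rooted configuration is the same thing as the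
sequence of its gaps, and changing the root amounts to shifting the sequence. The structure
`GapModel` records this correspondence, for the line and for the plane; it is measurable in both
directions by the Lusin–Souslin theorem (`exists_measurable_decoding`), and it turns point
stationarity into stationarity of the gap sequence. The weight that selects the point number zero
serves as `W`.

On the line, the Palm measure of a simple stationary process of intensity one is concentrated on
such configurations (`IsStationaryUnit.ae_good`): a simple configuration has at most one last point,
whereas by the Campbell formula the expected number of last points is zero or infinite. In the
plane, a monotone configuration through the origin whose projections are simple consists of the
pairs of points of the projections with equal numbers (`MonotoneConfig.eq_comb`), because it pairs
them by a monotone permutation of the integers that fixes zero. Hence Palm measures of monotone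
couplings are the same as stationary couplings of the gaps, which gives the bijection
(`iota_bijOn`), and the Campbell formula gives the equality of costs (`cost_eq_gapCost`). Finally,
the stationary couplings of two gap distributions form a nonempty weakly compact set, on which the
lower semicontinuous cost attains its minimum (`exists_gapCost_eq_iInf`).
-/

set_option linter.unusedSectionVars false

noncomputable section

namespace PointProcess

section PalmCalculus

variable {E : Type*} [NormedAddCommGroup E] [MeasureSpace E] [BorelSpace E]
  [SecondCountableTopology E]

/-! ### Shifts and integrals over configurations -/

theorem shift_shift (x y : E) (ξ : Config E) : shift x (shift y ξ) = shift (x + y) ξ := by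
  refine Subtype.ext ?_
  simp only [shift]
  rw [Measure.map_map (by fun_prop) (by fun_prop)]
  congr 1
  funext z
  simp only [Function.comp_apply]
  abel

@[simp]
theorem shift_zero (ξ : Config E) : shift 0 ξ = ξ := by
  refine Subtype.ext ?_
  simp [shift]

theorem lintegral_shift (x : E) (ξ : Config E) (f : E → ℝ≥0∞) :
    ∫⁻ y, f y ∂(shift x ξ).1 = ∫⁻ y, f (y - x) ∂ξ.1 := by
  exact lintegral_map_equiv f (MeasurableEquiv.subRight x)

theorem shift_apply (x : E) (ξ : Config E) (A : Set E) :
    (shift x ξ).1 A = ξ.1 ((fun y => y - x) ⁻¹' A) :=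
  (MeasurableEquiv.subRight x).map_apply A

theorem shift_singleton (x y : E) (ξ : Config E) : (shift x ξ).1 {y} = ξ.1 {y + x} := by
  rw [shift_apply]
  congr 1
  ext z
  simp [sub_eq_iff_eq_add]

theorem measurable_shift_comp {α : Type*} [MeasurableSpace α] {ξ : α → Config E} {x : α → E}
    (hx : Measurable x) (hξ : Measurable ξ) : Measurable fun a => shift (x a) (ξ a) :=
  measurable_shift.comp (hξ.prodMk hx)

theorem measurable_lintegral_config {α : Type*} [MeasurableSpace α] {ξ : α → Config E}
    (hξ : Measurable ξ) {F : α → E → ℝ≥0∞} (hF : Measurable (Function.uncurry F)) :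
    Measurable fun a => ∫⁻ x, F a x ∂(ξ a).1 :=
  Measurable.lintegral_kernel_prod_right (κ := (evalKernel E).comap ξ hξ) hF

instance instSFiniteConfig (ξ : Config E) : SFinite ξ.1 :=
  inferInstanceAs (SFinite (evalKernel E ξ))

/-! ### The refined Campbell formula -/

/-- `V` is the Palm measure of `Q` in the sense of the refined Campbell formula:
`∫ ∑_{x ∈ ξ} F (θ_x ξ, x) Q(dξ) = ∫ ∫ F (ξ, x) dx V(dξ)`. -/
def HasPalm (Q V : Measure (Config E)) : Prop :=
  ∀ F : Config E × E → ℝ≥0∞, Measurable F →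
    ∫⁻ ξ, ∫⁻ x, F (shift x ξ, x) ∂ξ.1 ∂Q = ∫⁻ ξ, ∫⁻ x, F (ξ, x) ∂volume ∂V

theorem lintegral_palm {B : Set E} (hB : MeasurableSet B) (Q : Measure (Config E)) [SFinite Q]
    {f : Config E → ℝ≥0∞} (hf : Measurable f) :
    ∫⁻ ξ, f ξ ∂(palm B hB Q) =
      (volume B)⁻¹ * ∫⁻ ξ, ∫⁻ x in B, f (shift x ξ) ∂ξ.1 ∂Q := by
  have h : palm B hB Q = (volume B)⁻¹ •
      (Q ⊗ₘ (evalKernel E).restrict hB).map (fun p => shift p.2 p.1) := by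
    ext A hA
    rw [palm, Measure.ofMeasurable_apply _ hA, Measure.smul_apply, smul_eq_mul,
      ← lintegral_indicator_one hA, lintegral_map (measurable_one.indicator hA) measurable_shift,
      Measure.lintegral_compProd (f := fun p => A.indicator 1 (shift p.2 p.1))
        ((measurable_one.indicator hA).comp measurable_shift)]
    simp only [Kernel.restrict_apply]
    rfl
  rw [h, lintegral_smul_measure, lintegral_map hf measurable_shift,
    Measure.lintegral_compProd (f := fun p => f (shift p.2 p.1)) (hf.comp measurable_shift),
    smul_eq_mul]
  simp only [Kernel.restrict_apply]
  rfl

theorem HasPalm.palm_eq {Q V : Measure (Config E)} [SFinite Q] (h : HasPalm Q V)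
    {B : Set E} (hB : MeasurableSet B) (h1 : volume B = 1) : palm B hB Q = V := by
  ext A hA
  rw [← lintegral_indicator_one hA, lintegral_palm hB Q (measurable_one.indicator hA), h1, inv_one,
    one_mul]
  have := h (fun p => A.indicator 1 p.1 * B.indicator 1 p.2)
    (((measurable_one.indicator hA).comp measurable_fst).mul
      ((measurable_one.indicator hB).comp measurable_snd))
  simp only at this
  have h2 : ∀ ξ : Config E, ∫⁻ x in B, A.indicator (1 : Config E → ℝ≥0∞) (shift x ξ) ∂ξ.1
      = ∫⁻ x, A.indicator 1 (shift x ξ) * B.indicator 1 x ∂ξ.1 := fun ξ => by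
    rw [← lintegral_indicator hB]
    refine lintegral_congr fun x => ?_
    by_cases hx : x ∈ B <;> simp [hx]
  simp_rw [h2, this]
  rw [← lintegral_indicator_one hA]
  refine lintegral_congr fun ξ => ?_
  rw [lintegral_const_mul _ (measurable_one.indicator hB), lintegral_indicator_one hB, h1, mul_one]

/-- The Palm measure of a stationary measure satisfies the refined Campbell formula: for fixed `A`,
the measure `D ↦ ∫ ∑_{x ∈ ξ ∩ D} 1_A (θ_x ξ) Q(dξ)` is translation invariant, hence a multiple of
Lebesgue measure. -/
theorem hasPalm_palm [LocallyCompactSpace E] [(volume : Measure E).IsAddHaarMeasure]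
    {Q : Measure (Config E)} [SFinite Q] (hQ : Stationary Q) {B : Set E} (hB : MeasurableSet B)
    (hi : (interior B).Nonempty) (hv : volume B ≠ ∞) [IsFiniteMeasure (palm B hB Q)] :
    HasPalm Q (palm B hB Q) := by
  have hm : Measurable fun p : Config E × E => (shift p.2 p.1, p.2) :=
    measurable_shift.prodMk measurable_snd
  have hv0 : volume B ≠ 0 := (Measure.measure_pos_of_nonempty_interior _ hi).ne'
  let C : Measure (Config E × E) := (Q ⊗ₘ evalKernel E).map (fun p => (shift p.2 p.1, p.2))
  have hC : ∀ F : Config E × E → ℝ≥0∞, Measurable F →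
      ∫⁻ p, F p ∂C = ∫⁻ ξ, ∫⁻ x, F (shift x ξ, x) ∂ξ.1 ∂Q := fun F hF => by
    rw [lintegral_map hF hm,
      Measure.lintegral_compProd (f := fun p => F (shift p.2 p.1, p.2)) (hF.comp hm)]
    rfl
  suffices h : (palm B hB Q).prod volume = C by
    intro F hF
    rw [← hC F hF, ← h, lintegral_prod _ hF.aemeasurable]
  refine Measure.prod_eq fun A D hA hD => ?_
  have hCAD : ∀ D, MeasurableSet D → C (A ×ˢ D) =
      ∫⁻ ξ, ∫⁻ x, A.indicator 1 (shift x ξ) * D.indicator 1 x ∂ξ.1 ∂Q := fun D hD => by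
    rw [← lintegral_indicator_one (hA.prod hD),
      hC _ (measurable_one.indicator (hA.prod hD))]
    refine lintegral_congr fun ξ => lintegral_congr fun x => ?_
    by_cases h1 : shift x ξ ∈ A <;> by_cases h2 : x ∈ D <;> simp [h1, h2]
  let ν : Measure E := (C.restrict (A ×ˢ univ)).map Prod.snd
  have hν : ∀ D, MeasurableSet D → ν D = C (A ×ˢ D) := fun D hD => by
    rw [Measure.map_apply measurable_snd hD, Measure.restrict_apply (measurable_snd hD)]
    congr 1
    ext p
    simp [and_comm]
  have hνB : ν B = volume B * palm B hB Q A := by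
    rw [hν B hB, hCAD B hB, palm, Measure.ofMeasurable_apply _ hA, ← mul_assoc,
      ENNReal.mul_inv_cancel hv0 hv, one_mul]
    refine lintegral_congr fun ξ => ?_
    rw [← lintegral_indicator hB]
    refine lintegral_congr fun x => ?_
    by_cases hx : x ∈ B <;> simp [hx]
  have hinv : ν.IsAddLeftInvariant := by
    refine ⟨fun z => ?_⟩
    ext D hD
    have hDz : MeasurableSet ((fun x => z + x) ⁻¹' D) := (measurable_const_add z) hD
    rw [Measure.map_apply (measurable_const_add z) hD, hν _ hDz, hν _ hD, hCAD _ hDz, hCAD _ hD]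
    have hG : Measurable fun ξ : Config E =>
        ∫⁻ x, A.indicator (1 : Config E → ℝ≥0∞) (shift x ξ) * D.indicator 1 x ∂ξ.1 :=
      measurable_lintegral_config measurable_id
        (F := fun ξ x => A.indicator (1 : Config E → ℝ≥0∞) (shift x ξ) * D.indicator 1 x)
        (((measurable_one.indicator hA).comp measurable_shift).mul
          ((measurable_one.indicator hD).comp measurable_snd))
    have hz : Measurable (shift (-z) : Config E → Config E) :=
      measurable_shift_comp measurable_const measurable_id
    conv_rhs => rw [← hQ (-z)]
    rw [lintegral_map hG hz]
    refine lintegral_congr fun ξ => ?_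
    rw [lintegral_shift]
    refine lintegral_congr fun x => ?_
    rw [shift_shift, sub_neg_eq_add, add_neg_cancel_right, add_comm x z]
    rfl
  have hfin : IsFiniteMeasureOnCompacts ν := by
    refine ⟨fun K hK => measure_lt_top_of_isCompact_of_isAddLeftInvariant (interior B)
      isOpen_interior hi (ne_top_of_le_ne_top ?_ (measure_mono interior_subset)) hK⟩
    rw [hνB]
    exact ENNReal.mul_ne_top hv (measure_ne_top _ _)
  have heq := Measure.isAddLeftInvariant_eq_smul ν (volume : Measure E)
  set c := Measure.addHaarScalarFactor ν (volume : Measure E)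
  have hc : (c : ℝ≥0∞) = palm B hB Q A := by
    have h1 : ν B = c * volume B := by
      conv_lhs => rw [heq]
      rw [Measure.smul_apply, ENNReal.smul_def, smul_eq_mul]
    rw [hνB, mul_comm] at h1
    exact ((ENNReal.mul_left_inj hv0 hv).1 h1).symm
  rw [← hν D hD, ← hc]
  conv_lhs => rw [heq]
  rw [Measure.smul_apply, ENNReal.smul_def, smul_eq_mul]

/-! ### Almost sure properties under `Q` and under its Palm measure -/

theorem HasPalm.ae_of_ae_palm {Q V : Measure (Config E)} (h : HasPalm Q V)
    {p : Config E → Prop} (hp : ∀ᵐ ξ ∂V, p ξ) : ∀ᵐ ξ ∂Q, ∀ᵐ x ∂ξ.1, p (shift x ξ) := by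
  obtain ⟨N, hpN, hN, hN0⟩ := exists_measurable_superset_of_null hp
  have h1 := h (fun q => N.indicator 1 q.1) ((measurable_one.indicator hN).comp measurable_fst)
  have h2 : ∫⁻ ξ, ∫⁻ x : E, N.indicator (1 : Config E → ℝ≥0∞) ξ ∂volume ∂V = 0 := by
    rw [lintegral_eq_zero_iff']
    · filter_upwards [measure_eq_zero_iff_ae_notMem.1 hN0] with ξ hξ
      simp [hξ]
    · simp only [lintegral_const]
      exact ((measurable_one.indicator hN).mul_const _).aemeasurable
  simp only at h1
  have h3 : Measurable fun ξ : Config E =>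
      ∫⁻ x, N.indicator (1 : Config E → ℝ≥0∞) (shift x ξ) ∂ξ.1 :=
    measurable_lintegral_config measurable_id
      (F := fun ξ x => N.indicator (1 : Config E → ℝ≥0∞) (shift x ξ))
      ((measurable_one.indicator hN).comp measurable_shift)
  rw [h2, lintegral_eq_zero_iff h3] at h1
  filter_upwards [h1] with ξ hξ
  simp only [Pi.zero_apply] at hξ
  have h4 : Measurable fun x : E => N.indicator (1 : Config E → ℝ≥0∞) (shift x ξ) :=
    (measurable_one.indicator hN).comp (measurable_shift_comp measurable_id measurable_const)
  rw [lintegral_eq_zero_iff h4] at hξ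
  filter_upwards [hξ] with x hx
  by_contra hc
  have : shift x ξ ∈ N := hpN hc
  simp [this] at hx

/-- A shift invariant property passes from the Palm measure to `Q`, apart from the empty
configuration. -/
theorem HasPalm.ae_of_ae_palm_of_ne_zero {Q V : Measure (Config E)} (h : HasPalm Q V)
    {p : Config E → Prop} (hs : ∀ x ξ, p ξ → p (shift x ξ)) (hp : ∀ᵐ ξ ∂V, p ξ)
    (h0 : ∀ᵐ ξ ∂Q, ξ.1 ≠ 0) : ∀ᵐ ξ ∂Q, p ξ := by
  filter_upwards [h.ae_of_ae_palm hp, h0] with ξ hξ hξ0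
  have : (ae ξ.1).NeBot := ae_neBot.2 hξ0
  obtain ⟨x, hx⟩ := hξ.exists
  simpa [shift_shift] using hs (-x) _ hx

/-- A shift invariant property passes from `Q` to its Palm measure. No measurability of `p` is
needed: for a measurable `Q`-null set `N` containing the exceptional set, the Campbell formula for
`F (ξ, x) = 1_N (θ_{-x} ξ)` shows that almost every translate of `V`-almost every `ξ` avoids `N`. -/
theorem HasPalm.ae_palm_of_ae [ProperSpace E] [(volume : Measure E).IsAddHaarMeasure]
    {Q V : Measure (Config E)} (h : HasPalm Q V) {p : Config E → Prop}
    (hs : ∀ x ξ, p ξ → p (shift x ξ))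
    (hp : ∀ᵐ ξ ∂Q, p ξ) : ∀ᵐ ξ ∂V, p ξ := by
  obtain ⟨N, hpN, hN, hN0⟩ := exists_measurable_superset_of_null hp
  have hmN : Measurable fun q : Config E × E =>
      N.indicator (1 : Config E → ℝ≥0∞) (shift (-q.2) q.1) :=
    (measurable_one.indicator hN).comp
      (measurable_shift_comp measurable_snd.neg measurable_fst)
  have h1 := h _ hmN
  have h2 : ∫⁻ ξ, ∫⁻ x, N.indicator (1 : Config E → ℝ≥0∞) (shift (-x) (shift x ξ)) ∂ξ.1 ∂Q = 0 := by
    simp only [shift_shift, neg_add_cancel, shift_zero, lintegral_const]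
    have : (fun ξ : Config E => N.indicator (1 : Config E → ℝ≥0∞) ξ * ξ.1 univ) =ᵐ[Q] 0 := by
      filter_upwards [measure_eq_zero_iff_ae_notMem.1 hN0] with ξ hξ
      simp [hξ]
    rw [lintegral_congr_ae this]
    simp
  simp only at h1
  rw [h2, eq_comm, lintegral_eq_zero_iff (Measurable.lintegral_prod_right' hmN)] at h1
  filter_upwards [h1] with ξ hξ
  simp only [Pi.zero_apply] at hξ
  have h4 : Measurable fun x : E => N.indicator (1 : Config E → ℝ≥0∞) (shift (-x) ξ) :=
    hmN.comp measurable_prodMk_left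
  rw [lintegral_eq_zero_iff h4] at hξ
  obtain ⟨x, hx⟩ := hξ.exists
  have hx' : p (shift (-x) ξ) := by
    by_contra hc
    have : shift (-x) ξ ∈ N := hpN hc
    simp [this] at hx
  simpa [shift_shift] using hs x _ hx'

/-! ### The exchange formula -/

/-- The invariance of Palm measures under changes of the reference point:
`∫ ∑_{y ∈ ξ} g (ξ, y) V(dξ) = ∫ ∑_{y ∈ ξ} g (θ_y ξ, -y) V(dξ)`. -/
def IsPointStationary (V : Measure (Config E)) : Prop :=
  ∀ g : Config E × E → ℝ≥0∞, Measurable g →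
    ∫⁻ ξ, ∫⁻ y, g (ξ, y) ∂ξ.1 ∂V = ∫⁻ ξ, ∫⁻ y, g (shift y ξ, -y) ∂ξ.1 ∂V

theorem exists_measurable_lintegral_eq_one [(volume : Measure E).IsAddHaarMeasure]
    [ProperSpace E] : ∃ k : E → ℝ≥0∞, Measurable k ∧ ∫⁻ x, k x = 1 := by
  have h0 : volume (Metric.ball (0 : E) 1) ≠ 0 := (Metric.measure_ball_pos _ _ one_pos).ne'
  have h1 : volume (Metric.ball (0 : E) 1) ≠ ∞ := measure_ball_lt_top.ne
  refine ⟨(Metric.ball (0 : E) 1).indicator fun _ => (volume (Metric.ball (0 : E) 1))⁻¹,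
    measurable_const.indicator Metric.isOpen_ball.measurableSet, ?_⟩
  rw [lintegral_indicator_const Metric.isOpen_ball.measurableSet, ENNReal.inv_mul_cancel h0 h1]

/-- Mecke's argument: inserting a probability density `k` in the reference point turns the left hand
side of the exchange formula into an integral under `Q` of a sum over pairs of points of `ξ`, where
the roles of the two points can be exchanged. -/
theorem HasPalm.isPointStationary [(volume : Measure E).IsAddHaarMeasure] [ProperSpace E]
    {Q V : Measure (Config E)} (h : HasPalm Q V) : IsPointStationary V := by
  intro g hg
  obtain ⟨k, hk, hk1⟩ := exists_measurable_lintegral_eq_one (E := E)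
  have hgi : Measurable fun ξ : Config E => ∫⁻ y, g (ξ, y) ∂ξ.1 :=
    measurable_lintegral_config measurable_id (F := fun ξ y => g (ξ, y)) hg
  have e1 : ∫⁻ ξ, ∫⁻ y, g (ξ, y) ∂ξ.1 ∂V =
      ∫⁻ ξ, ∫⁻ x, (fun q : Config E × E => k q.2 * ∫⁻ y, g (q.1, y) ∂q.1.1) (ξ, x) ∂volume ∂V := by
    refine lintegral_congr fun ξ => ?_
    simp only
    rw [lintegral_mul_const _ hk, hk1, one_mul]
  have hF' : Measurable fun q : Config E × E =>
      ∫⁻ y, k (y + q.2) * g (shift y q.1, -y) ∂q.1.1 :=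
    measurable_lintegral_config measurable_fst
      (F := fun (q : Config E × E) y => k (y + q.2) * g (shift y q.1, -y))
      ((hk.comp (measurable_snd.add measurable_fst.snd)).mul
        (hg.comp ((measurable_shift_comp measurable_snd measurable_fst.fst).prodMk
          measurable_snd.neg)))
  have e2 : ∫⁻ ξ, ∫⁻ y, g (shift y ξ, -y) ∂ξ.1 ∂V = ∫⁻ ξ, ∫⁻ x,
      (fun q : Config E × E => ∫⁻ y, k (y + q.2) * g (shift y q.1, -y) ∂q.1.1) (ξ, x)
      ∂volume ∂V := by
    refine lintegral_congr fun ξ => ?_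
    simp only
    rw [lintegral_lintegral_swap]
    · refine lintegral_congr fun y => ?_
      have hky : Measurable fun x => k (y + x) := hk.comp (measurable_const_add y)
      rw [lintegral_mul_const _ hky, lintegral_add_left_eq_self k y, hk1, one_mul]
    · exact ((hk.comp (measurable_snd.add measurable_fst)).mul
        (hg.comp ((measurable_shift_comp measurable_snd measurable_const).prodMk
          measurable_snd.neg))).aemeasurable
  have hF : Measurable fun q : Config E × E => k q.2 * ∫⁻ y, g (q.1, y) ∂q.1.1 :=
    (hk.comp measurable_snd).mul (hgi.comp measurable_fst)
  rw [e1, e2, ← h _ hF, ← h _ hF']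
  refine lintegral_congr fun ξ => ?_
  simp only [lintegral_shift, shift_shift, sub_add_cancel, neg_sub]
  have hmg : Measurable fun p : E × E => k p.1 * g (shift p.1 ξ, p.2 - p.1) :=
    (hk.comp measurable_fst).mul (hg.comp ((measurable_shift_comp measurable_fst
      measurable_const).prodMk (measurable_snd.sub measurable_fst)))
  have e3 : ∀ x, k x * ∫⁻ y, g (shift x ξ, y - x) ∂ξ.1 =
      ∫⁻ y, k x * g (shift x ξ, y - x) ∂ξ.1 := fun x => by
    rw [lintegral_const_mul]
    exact hg.comp (measurable_const.prodMk (measurable_id.sub_const x))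
  simp_rw [e3]
  exact lintegral_lintegral_swap hmg.aemeasurable

/-! ### Inversion of the Palm measure -/

/-- The weights `W (θ_x ξ, x + a)`, `x ∈ ξ`, sum to one for every `a`. Weights with this property
reconstruct a stationary measure from its Palm measure. -/
def IsUnitWeight (W : Config E × E → ℝ≥0∞) (ξ : Config E) : Prop :=
  ∀ a, ∫⁻ x, W (shift x ξ, x + a) ∂ξ.1 = 1

theorem IsUnitWeight.shift {W : Config E × E → ℝ≥0∞} {ξ : Config E} (h : IsUnitWeight W ξ)
    (z : E) : IsUnitWeight W (shift z ξ) := by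
  intro a
  rw [lintegral_shift, ← h (a - z)]
  refine lintegral_congr fun x => ?_
  rw [shift_shift, sub_add_cancel]
  congr 2
  abel

theorem HasPalm.lintegral_eq {Q V : Measure (Config E)} (h : HasPalm Q V)
    {W : Config E × E → ℝ≥0∞} (hW : Measurable W) (hQ : ∀ᵐ ξ ∂Q, IsUnitWeight W ξ)
    {f : Config E → ℝ≥0∞} (hf : Measurable f) :
    ∫⁻ ξ, f ξ ∂Q = ∫⁻ ξ, ∫⁻ z, W (ξ, z) * f (shift (-z) ξ) ∂volume ∂V := by
  rw [← h (fun q => W q * f (PointProcess.shift (-q.2) q.1))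
    (hW.mul (hf.comp (measurable_shift_comp measurable_snd.neg measurable_fst)))]
  refine lintegral_congr_ae ?_
  filter_upwards [hQ] with ξ hξ
  simp only [shift_shift, neg_add_cancel, shift_zero]
  rw [lintegral_mul_const]
  · have := hξ 0
    simp only [add_zero] at this
    rw [this, one_mul]
  · exact hW.comp ((measurable_shift_comp measurable_id measurable_const).prodMk measurable_id)

/-- A measure that does not charge the configurations without unit weights is determined by its
Palm measure. -/
theorem HasPalm.unique {Q Q' V : Measure (Config E)} (h : HasPalm Q V) (h' : HasPalm Q' V)
    {W : Config E × E → ℝ≥0∞} (hW : Measurable W) (hQ : ∀ᵐ ξ ∂Q, IsUnitWeight W ξ)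
    (hQ' : ∀ᵐ ξ ∂Q', IsUnitWeight W ξ) : Q = Q' := by
  ext A hA
  rw [← lintegral_indicator_one hA, ← lintegral_indicator_one hA,
    h.lintegral_eq hW hQ (measurable_one.indicator hA),
    h'.lintegral_eq hW hQ' (measurable_one.indicator hA)]

/-- The measure with Palm measure `V`, reconstructed by means of the weights `W`. -/
def palmInverse (W : Config E × E → ℝ≥0∞) (V : Measure (Config E)) : Measure (Config E) :=
  ((V.prod volume).withDensity W).map fun q => shift (-q.2) q.1

section Inverse

variable {V : Measure (Config E)} {W : Config E × E → ℝ≥0∞}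

theorem measurable_shift_neg : Measurable fun q : Config E × E => shift (-q.2) q.1 :=
  measurable_shift_comp measurable_snd.neg measurable_fst

theorem lintegral_palmInverse [SFinite (volume : Measure E)] (hW : Measurable W)
    {f : Config E → ℝ≥0∞} (hf : Measurable f) :
    ∫⁻ ξ, f ξ ∂(palmInverse W V) = ∫⁻ ξ, ∫⁻ z, W (ξ, z) * f (shift (-z) ξ) ∂volume ∂V := by
  have hfs : Measurable fun q : Config E × E => f (shift (-q.2) q.1) :=
    hf.comp measurable_shift_neg
  rw [palmInverse, lintegral_map hf measurable_shift_neg,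
    lintegral_withDensity_eq_lintegral_mul _ hW hfs, lintegral_prod _ (hW.mul hfs).aemeasurable]
  rfl

instance instSFinitePalmInverse [SFinite (volume : Measure E)] [SFinite V] :
    SFinite (palmInverse W V) := by
  unfold palmInverse
  infer_instance

theorem ae_ne_zero_palmInverse [SFinite (volume : Measure E)] (hW : Measurable W)
    (hu : ∀ᵐ ξ ∂V, IsUnitWeight W ξ) : ∀ᵐ ξ ∂(palmInverse W V), ξ.1 ≠ 0 := by
  have hm : MeasurableSet {ξ : Config E | ξ.1 univ = 0} :=
    ((Measure.measurable_coe MeasurableSet.univ).comp measurable_subtype_coe)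
      (measurableSet_singleton 0)
  have h0 : palmInverse W V {ξ : Config E | ξ.1 univ = 0} = 0 := by
    rw [← lintegral_indicator_one hm, lintegral_palmInverse hW (measurable_one.indicator hm),
      lintegral_congr_ae (g := fun _ => 0), lintegral_zero]
    filter_upwards [hu] with ξ hξ
    have h1 : ξ.1 univ ≠ 0 := fun h => by
      have := hξ 0
      rw [Measure.measure_univ_eq_zero.1 h] at this
      simp at this
    have h2 : ∀ z, shift (-z) ξ ∉ {ξ : Config E | ξ.1 univ = 0} := fun z => by
      rw [mem_ofPred_eq, shift_apply, preimage_univ]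
      exact h1
    simp only [indicator_of_notMem (h2 _), mul_zero, lintegral_zero]
  filter_upwards [measure_eq_zero_iff_ae_notMem.1 h0] with ξ hξ h
  exact hξ (by simp [h])

/-- Both sides of the refined Campbell formula are brought to the same form by the exchange formula
for `g (ξ, y) = ∫ W (θ_y ξ, z) F (ξ, z - y) dz`; the weights then sum to one. -/
theorem hasPalm_palmInverse [(volume : Measure E).IsAddHaarMeasure] [ProperSpace E]
    (hV : IsPointStationary V) (hW : Measurable W)
    (hu : ∀ᵐ ξ ∂V, IsUnitWeight W ξ) : HasPalm (palmInverse W V) V := by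
  intro F hF
  have hFs : Measurable fun ξ : Config E => ∫⁻ x, F (shift x ξ, x) ∂ξ.1 :=
    measurable_lintegral_config measurable_id (F := fun ξ x => F (shift x ξ, x))
      (hF.comp (measurable_shift.prodMk measurable_snd))
  rw [lintegral_palmInverse hW hFs]
  have hg : Measurable fun q : Config E × E => ∫⁻ z, W (shift q.2 q.1, z) * F (q.1, z - q.2) :=
    Measurable.lintegral_prod_right'
      (f := fun r : (Config E × E) × E => W (shift r.1.2 r.1.1, r.2) * F (r.1.1, r.2 - r.1.2))
      ((hW.comp ((measurable_shift_comp measurable_fst.snd measurable_fst.fst).prodMk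
        measurable_snd)).mul (hF.comp (measurable_fst.fst.prodMk
          (measurable_snd.sub measurable_fst.snd))))
  have e1 : ∀ ξ : Config E,
      ∫⁻ z, W (ξ, z) * ∫⁻ x, F (shift x (shift (-z) ξ), x) ∂(shift (-z) ξ).1 =
      ∫⁻ y, ∫⁻ z, W (shift (-y) (shift y ξ), z) * F (shift y ξ, z - -y) ∂volume ∂ξ.1 := fun ξ => by
    simp only [lintegral_shift, shift_shift, neg_add_cancel, shift_zero, sub_neg_eq_add,
      add_neg_cancel_right]
    have e3 : ∀ z, W (ξ, z) * ∫⁻ x, F (shift x ξ, x + z) ∂ξ.1 =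
        ∫⁻ x, W (ξ, z) * F (shift x ξ, x + z) ∂ξ.1 := fun z => by
      rw [lintegral_const_mul]
      exact hF.comp ((measurable_shift_comp measurable_id measurable_const).prodMk
        (measurable_id.add_const z))
    simp_rw [e3]
    rw [lintegral_lintegral_swap]
    · simp_rw [add_comm]
    · exact ((hW.comp (measurable_const.prodMk measurable_fst)).mul (hF.comp
        ((measurable_shift_comp measurable_snd measurable_const).prodMk
          (measurable_snd.add measurable_fst)))).aemeasurable
  simp_rw [e1]
  rw [← hV _ hg]
  refine lintegral_congr_ae ?_
  filter_upwards [hu] with ξ hξ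
  have e4 : ∀ y, ∫⁻ z, W (shift y ξ, z) * F (ξ, z - y) =
      ∫⁻ z, W (shift y ξ, y + z) * F (ξ, z) := fun y => by
    rw [← lintegral_add_left_eq_self _ y]
    simp only [add_sub_cancel_left]
  simp only [e4]
  rw [lintegral_lintegral_swap]
  · refine lintegral_congr fun z => ?_
    rw [lintegral_mul_const, hξ z, one_mul]
    exact hW.comp ((measurable_shift_comp measurable_id measurable_const).prodMk
      (measurable_id.add_const z))
  · exact ((hW.comp ((measurable_shift_comp measurable_fst measurable_const).prodMk
      (measurable_fst.add measurable_snd))).mul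
        (hF.comp (measurable_const.prodMk measurable_snd))).aemeasurable

/-- The weights in the definition of `palmInverse W V` may be evaluated at the points translated by
any `a`, by the Campbell formula. -/
theorem stationary_palmInverse [(volume : Measure E).IsAddHaarMeasure] [ProperSpace E]
    (hV : IsPointStationary V) (hW : Measurable W)
    (hu : ∀ᵐ ξ ∂V, IsUnitWeight W ξ) : Stationary (palmInverse W V) := by
  intro a
  have ha : Measurable (PointProcess.shift a : Config E → Config E) :=
    measurable_shift_comp measurable_const measurable_id
  ext A hA
  have h1A : Measurable (A.indicator (1 : Config E → ℝ≥0∞)) := measurable_one.indicator hA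
  rw [← lintegral_indicator_one hA, lintegral_map h1A ha,
    lintegral_palmInverse (f := fun ξ => A.indicator 1 (PointProcess.shift a ξ)) hW (h1A.comp ha),
    ← lintegral_indicator_one hA]
  have hm : Measurable fun q : Config E × E =>
      W (q.1, q.2 + a) * A.indicator 1 (shift (-q.2) q.1) :=
    (hW.comp (measurable_fst.prodMk (measurable_snd.add_const a))).mul
      (h1A.comp measurable_shift_neg)
  have e1 : ∀ ξ : Config E, ∫⁻ z, W (ξ, z) * A.indicator 1 (shift a (shift (-z) ξ)) =
      ∫⁻ z, W (ξ, z + a) * A.indicator 1 (shift (-z) ξ) := fun ξ => by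
    rw [← lintegral_add_right_eq_self _ a]
    simp [shift_shift]
  simp_rw [e1]
  rw [← hasPalm_palmInverse hV hW hu _ hm]
  refine lintegral_congr_ae ?_
  filter_upwards [(hasPalm_palmInverse hV hW hu).ae_of_ae_palm_of_ne_zero
    (fun x ξ h => h.shift x) hu (ae_ne_zero_palmInverse hW hu)] with ξ hξ
  simp only [shift_shift, neg_add_cancel, shift_zero]
  rw [lintegral_mul_const, hξ a, one_mul]
  exact hW.comp ((measurable_shift_comp measurable_id measurable_const).prodMk
      (measurable_id.add_const a))

/-- The set of configurations whose weights in a ball sum to at least `1/2` has finite measure, by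
the Campbell formula; these sets exhaust the configurations with unit weights. -/
theorem sigmaFinite_palmInverse [(volume : Measure E).IsAddHaarMeasure] [ProperSpace E]
    [IsFiniteMeasure V]
    (hV : IsPointStationary V) (hW : Measurable W) (hW1 : ∀ q, W q ≤ 1)
    (hu : ∀ᵐ ξ ∂V, IsUnitWeight W ξ) : SigmaFinite (palmInverse W V) := by
  let b : ℕ → Set E := fun n => Metric.ball 0 n
  have hb : ∀ n, MeasurableSet (b n) := fun n => Metric.isOpen_ball.measurableSet
  let F : ℕ → Config E × E → ℝ≥0∞ := fun n q => (b n).indicator 1 q.2 * W q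
  have hF : ∀ n, Measurable (F n) := fun n =>
    ((measurable_one.indicator (hb n)).comp measurable_snd).mul hW
  let h : ℕ → Config E → ℝ≥0∞ := fun n ξ => ∫⁻ x, F n (shift x ξ, x) ∂ξ.1
  have hh : ∀ n, Measurable (h n) := fun n =>
    measurable_lintegral_config measurable_id (F := fun ξ x => F n (shift x ξ, x))
      ((hF n).comp (measurable_shift.prodMk measurable_snd))
  have hP := hasPalm_palmInverse hV hW hu
  have hfin : ∀ n, ∫⁻ ξ, h n ξ ∂(palmInverse W V) < ∞ := fun n => by
    rw [hP _ (hF n)]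
    calc ∫⁻ ξ, ∫⁻ x, F n (ξ, x) ∂volume ∂V
        ≤ ∫⁻ ξ, ∫⁻ x, (b n).indicator 1 x ∂volume ∂V := by
          refine lintegral_mono fun ξ => lintegral_mono fun x => ?_
          exact mul_le_of_le_one_right' (hW1 _)
      _ = volume (b n) * V univ := by
          rw [lintegral_const, lintegral_indicator_one (hb n)]
      _ < ∞ := ENNReal.mul_lt_top measure_ball_lt_top (measure_lt_top _ _)
  let A : ℕ → Set (Config E) := fun n => {ξ | 2⁻¹ ≤ h n ξ}
  have hA0 : palmInverse W V (⋃ n, A n)ᶜ = 0 := by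
    rw [← mem_ae_iff]
    filter_upwards [hP.ae_of_ae_palm_of_ne_zero (fun x ξ h => h.shift x) hu
      (ae_ne_zero_palmInverse hW hu)] with ξ hξ
    have h1 := hξ 0
    simp only [add_zero] at h1
    have hm : Measurable fun x => W (shift x ξ, x) :=
      hW.comp ((measurable_shift_comp measurable_id measurable_const).prodMk measurable_id)
    have h2 : ⨆ n, h n ξ = 1 := by
      rw [← h1, ← setLIntegral_univ, ← Metric.iUnion_ball_nat (0 : E),
        setLIntegral_iUnion_of_directed]
      · refine iSup_congr fun n => ?_
        rw [← lintegral_indicator (hb n)]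
        refine lintegral_congr fun x => ?_
        by_cases hx : x ∈ b n <;> simp [F, hx]
      · exact Monotone.directed_le fun m n hmn =>
          Metric.ball_subset_ball (by exact_mod_cast hmn)
    have h3 : (2⁻¹ : ℝ≥0∞) < ⨆ n, h n ξ := by
      rw [h2]
      exact ENNReal.inv_lt_one.2 (by norm_num)
    obtain ⟨n, hn⟩ := lt_iSup_iff.1 h3
    exact mem_iUnion.2 ⟨n, hn.le⟩
  refine ⟨⟨⟨fun n => A n ∪ (⋃ n, A n)ᶜ, fun _ => trivial, fun n => ?_, ?_⟩⟩⟩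
  · refine (measure_union_le _ _).trans_lt ?_
    rw [hA0, add_zero]
    refine (meas_ge_le_lintegral_div (hh n).aemeasurable (by norm_num) (by norm_num)).trans_lt ?_
    exact ENNReal.div_lt_top (hfin n).ne (by norm_num)
  · rw [← iUnion_union, union_compl_self]

end Inverse

end PalmCalculus

/-! ### Counting measures are purely atomic -/

section Atoms

variable {E : Type*} [NormedAddCommGroup E] [MeasurableSpace E] [BorelSpace E]
  [SecondCountableTopology E]

/-- The masses of the balls around `x` without their centre are integers that decrease to zero. -/
theorem IsCounting.exists_ball_diff_null {μ : Measure E} (h : IsCounting μ) (x : E) :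
    ∃ r > 0, μ (Metric.ball x r \ {x}) = 0 := by
  let B : ℕ → Set E := fun n => Metric.ball x (1 / (n + 1 : ℝ)) \ {x}
  have hBm : ∀ n, MeasurableSet (B n) := fun n =>
    Metric.isOpen_ball.measurableSet.diff (measurableSet_singleton x)
  have hBb : ∀ n, Bornology.IsBounded (B n) := fun n => Metric.isBounded_ball.subset sdiff_subset
  have hanti : Antitone B := fun m n hmn =>
    sdiff_subset_sdiff_left (Metric.ball_subset_ball (Nat.one_div_le_one_div hmn))
  have hI : ⋂ n, B n = ∅ := by
    refine eq_empty_iff_forall_notMem.2 fun y hy => ?_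
    have hy' := fun n => mem_iInter.1 hy n
    have hxy : 0 < dist y x := dist_pos.2 fun h => (hy' 0).2 h
    obtain ⟨n, hn⟩ := exists_nat_one_div_lt hxy
    exact absurd (hy' n).1 (by simpa using hn.le)
  have hfin : μ (B 0) ≠ ∞ := by
    obtain ⟨n, hn⟩ := h _ (hBm 0) (hBb 0)
    rw [hn]
    exact ENNReal.natCast_ne_top n
  have ht := tendsto_measure_iInter_atTop (μ := μ) (fun n => (hBm n).nullMeasurableSet) hanti
    ⟨0, hfin⟩
  rw [hI, measure_empty] at ht
  obtain ⟨n, hn⟩ := (ht.eventually (gt_mem_nhds (zero_lt_one (α := ℝ≥0∞)))).exists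
  refine ⟨1 / (n + 1 : ℝ), by positivity, ?_⟩
  obtain ⟨m, hm⟩ := h _ (hBm n) (hBb n)
  simp only [Function.comp_apply] at hn
  rw [hm] at hn
  have : m = 0 := by
    have : m < 1 := by exact_mod_cast hn
    omega
  change μ (B n) = 0
  rw [hm, this, Nat.cast_zero]

theorem IsCounting.measure_non_atoms {μ : Measure E} (h : IsCounting μ) :
    μ {x | μ {x} = 0} = 0 := by
  refine measure_null_of_locally_null _ fun x hx => ?_
  obtain ⟨r, hr, h0⟩ := h.exists_ball_diff_null x
  refine ⟨Metric.ball x r, mem_nhdsWithin_of_mem_nhds (Metric.ball_mem_nhds x hr), ?_⟩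
  refine measure_mono_null (t := (Metric.ball x r \ {x}) ∪ {x}) ?_ (measure_union_null h0 hx)
  rw [sdiff_union_self]
  exact subset_union_left

theorem IsCounting.exists_atom {μ : Measure E} (h : IsCounting μ) {A : Set E} (hA : μ A ≠ 0) :
    ∃ x ∈ A, μ {x} ≠ 0 := by
  by_contra! hc
  exact hA (measure_mono_null (fun x hx => hc x hx) h.measure_non_atoms)

theorem IsCounting.finite_atoms {μ : Measure E} (h : IsCounting μ) {K : Set E}
    (hK : IsCompact K) : (K ∩ {x | μ {x} ≠ 0}).Finite := by
  refine hK.induction_on (p := fun s => (s ∩ {x | μ {x} ≠ 0}).Finite) (by simp)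
    (fun s t hst ht => ht.subset (inter_subset_inter_left _ hst))
    (fun s t hs ht => by rw [union_inter_distrib_right]; exact hs.union ht) fun x _ => ?_
  obtain ⟨r, hr, h0⟩ := h.exists_ball_diff_null x
  refine ⟨Metric.ball x r, mem_nhdsWithin_of_mem_nhds (Metric.ball_mem_nhds x hr), ?_⟩
  refine (finite_singleton x).subset fun y hy => ?_
  by_contra hxy
  have hy' : y ∈ Metric.ball x r \ {x} := ⟨hy.1, hxy⟩
  exact hy.2 (measure_mono_null (singleton_subset_iff.2 hy') h0)

end Atoms

/-! ### Sums of Dirac masses along a sequence -/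

section Comb

variable {E : Type*} [MeasurableSpace E]

/-- The counting measure `∑ i, δ_{t i}` of the points `t i`. -/
def comb (t : ℤ → E) : Measure E := Measure.sum fun i => Measure.dirac (t i)

theorem comb_apply (t : ℤ → E) {A : Set E} (hA : MeasurableSet A) :
    comb t A = ∑' i, A.indicator 1 (t i) := by
  rw [comb, Measure.sum_apply _ hA]
  simp only [Measure.dirac_apply' _ hA]

theorem map_comb {F : Type*} [MeasurableSpace F] {f : E → F} (hf : Measurable f) (t : ℤ → E) :
    (comb t).map f = comb (f ∘ t) := by
  rw [comb, Measure.map_sum hf.aemeasurable]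
  simp only [Measure.map_dirac' hf]
  rfl

theorem comb_comp_equiv (t : ℤ → E) (e : ℤ ≃ ℤ) : comb (t ∘ e) = comb t := by
  ext A hA
  rw [comb_apply _ hA, comb_apply _ hA]
  exact e.tsum_eq fun i => A.indicator (1 : E → ℝ≥0∞) (t i)

variable [MeasurableSingletonClass E]

theorem lintegral_comb (t : ℤ → E) (f : E → ℝ≥0∞) : ∫⁻ x, f x ∂(comb t) = ∑' i, f (t i) := by
  rw [comb, lintegral_sum_measure]
  simp only [lintegral_dirac]

theorem comb_singleton_ne_zero_iff (t : ℤ → E) (x : E) : comb t {x} ≠ 0 ↔ ∃ i, t i = x := by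
  rw [comb_apply _ (measurableSet_singleton x), Ne, ENNReal.tsum_eq_zero]
  simp

theorem comb_singleton_of_injective {t : ℤ → E} (ht : Function.Injective t) (i : ℤ) :
    comb t {t i} = 1 := by
  rw [comb_apply _ (measurableSet_singleton _), tsum_eq_single i]
  · simp
  · intro j hj
    simp [ht.ne hj]

theorem isCounting_comb {F : Type*} [NormedAddCommGroup F] [MeasurableSpace F] {t : ℤ → F}
    (h : ∀ R : ℝ, {i | ‖t i‖ ≤ R}.Finite) : IsCounting (comb t) := by
  intro A hA hb
  obtain ⟨R, hR⟩ := hb.exists_norm_le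
  have hf : {i | t i ∈ A}.Finite := (h R).subset fun i hi => hR _ hi
  refine ⟨hf.toFinset.card, ?_⟩
  rw [comb_apply _ hA, tsum_eq_sum (s := hf.toFinset)]
  · rw [Finset.sum_congr rfl (g := fun _ => 1)]
    · simp
    · intro i hi
      have : t i ∈ A := by simpa using hi
      simp [this]
  · intro i hi
    have : t i ∉ A := by simpa using hi
    simp [this]

theorem IsCounting.eq_comb {F : Type*} [NormedAddCommGroup F] [MeasurableSpace F] [BorelSpace F]
    [SecondCountableTopology F] {μ : Measure F} (h : IsCounting μ) {t : ℤ → F}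
    (ht : Function.Injective t) (h1 : ∀ i, μ {t i} = 1)
    (hsurj : ∀ x, μ {x} ≠ 0 → ∃ i, t i = x) : μ = comb t := by
  ext A hA
  have hnull : μ (range t)ᶜ = 0 := measure_mono_null (fun x hx => by
    by_contra hc
    exact hx (hsurj x hc)) h.measure_non_atoms
  have hAt : μ A = μ (⋃ i, A ∩ {t i}) := by
    rw [← inter_iUnion, iUnion_singleton_eq_range]
    exact (measure_inter_conull hnull).symm
  rw [hAt, measure_iUnion _ fun i => hA.inter (measurableSet_singleton _), comb_apply _ hA]
  · refine tsum_congr fun i => ?_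
    by_cases hi : t i ∈ A
    · rw [inter_eq_right.2 (singleton_subset_iff.2 hi), h1]
      simp [hi]
    · rw [inter_singleton_eq_empty.2 hi]
      simp [hi]
  · intro i j hij
    exact (disjoint_singleton.2 (ht.ne hij)).mono inter_subset_right inter_subset_right

/-- A counting measure on the line with simple points and without first or last point, one of the
points being the origin, is enumerated by the integers. -/
theorem IsCounting.exists_strictMono_comb {μ : Measure ℝ} (h : IsCounting μ)
    (hs : ∀ x, μ {x} = 0 ∨ μ {x} = 1) (h0 : μ {0} ≠ 0)
    (hr : ∀ x, μ {x} ≠ 0 → μ (Ioi x) ≠ 0) (hl : ∀ x, μ {x} ≠ 0 → μ (Iio x) ≠ 0) :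
    ∃ t : ℤ → ℝ, StrictMono t ∧ t 0 = 0 ∧ μ = comb t ∧ (∀ n : ℕ, ∃ i, (n : ℝ) ≤ t i) ∧
      ∀ n : ℕ, ∃ i, t i ≤ -n := by
  classical
  let S : Set ℝ := {x | μ {x} ≠ 0}
  have hfin : ∀ a b : S, (Set.Icc a b).Finite := fun a b => by
    refine Finite.of_finite_image (f := Subtype.val)
      ((h.finite_atoms (isCompact_Icc (a := (a : ℝ)) (b := b))).subset ?_)
      Subtype.val_injective.injOn
    rintro _ ⟨x, hx, rfl⟩
    exact ⟨hx, x.2⟩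
  let _ : LocallyFiniteOrder S := LocallyFiniteOrder.ofFiniteIcc hfin
  let _ : SuccOrder S := LinearLocallyFiniteOrder.succOrder S
  let _ : PredOrder S := LinearLocallyFiniteOrder.predOrder S
  have _ : NoMaxOrder S := ⟨fun x => by
    obtain ⟨y, hy, hy'⟩ := h.exists_atom (hr x x.2)
    exact ⟨⟨y, hy'⟩, hy⟩⟩
  have _ : NoMinOrder S := ⟨fun x => by
    obtain ⟨y, hy, hy'⟩ := h.exists_atom (hl x x.2)
    exact ⟨⟨y, hy'⟩, hy⟩⟩
  have _ : Nonempty S := ⟨⟨0, h0⟩⟩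
  let e : S ≃o ℤ := orderIsoIntOfLinearSuccPredArch
  let z : S := ⟨0, h0⟩
  let t : ℤ → ℝ := fun i => e.symm (i + e z)
  have htS : ∀ i, μ {t i} ≠ 0 := fun i => (e.symm (i + e z)).2
  have ht : StrictMono t := fun i j hij => by
    have : e.symm (i + e z) < e.symm (j + e z) := e.symm.strictMono (by omega)
    exact this
  have hsurj : ∀ x, μ {x} ≠ 0 → ∃ i, t i = x := fun x hx =>
    ⟨e ⟨x, hx⟩ - e z, by simp [t]⟩
  have ht0 : t 0 = 0 := by simp [t, z]
  have hinf : ∀ (K : Set ℝ) (_ : IsCompact K) (f : ℕ → ℤ) (_ : Function.Injective f),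
      ∃ n, t (f n) ∉ K := by
    intro K hK f hf
    by_contra! hc
    exact Set.infinite_of_injective_forall_mem (ht.injective.comp hf)
      (fun n => (show t (f n) ∈ K ∩ {x | μ {x} ≠ 0} from ⟨hc n, htS (f n)⟩)) (h.finite_atoms hK)
  refine ⟨t, ht, ht0, ?_, fun n => ?_, fun n => ?_⟩
  · exact h.eq_comb ht.injective (fun i => (hs _).resolve_left (htS i)) hsurj
  · obtain ⟨m, hm⟩ := hinf (Icc 0 n) isCompact_Icc (fun k => (k : ℤ)) Nat.cast_injective
    refine ⟨m, ?_⟩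
    by_contra hc
    exact hm ⟨ht0 ▸ ht.monotone (Int.natCast_nonneg m), (not_le.1 hc).le⟩
  · obtain ⟨m, hm⟩ := hinf (Icc (-n) 0) isCompact_Icc (fun k => -(k : ℤ))
      (neg_injective.comp Nat.cast_injective)
    refine ⟨-m, ?_⟩
    by_contra hc
    exact hm ⟨(not_le.1 hc).le, ht0 ▸ ht.monotone (by simp)⟩

end Comb

/-! ### Uniqueness of numberings -/

theorem int_eq_add_of_monotone_of_bijective {φ : ℤ → ℤ} (hm : Monotone φ)
    (hb : Function.Bijective φ) (i : ℤ) : φ i = i + φ 0 := by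
  have hs : StrictMono φ := hm.strictMono_of_injective hb.1
  have hstep : ∀ i, φ (i + 1) = φ i + 1 := fun i => by
    obtain ⟨j, hj⟩ := hb.2 (φ i + 1)
    have h1 : i < j := hs.lt_iff_lt.1 (by omega)
    have h2 : φ i < φ (i + 1) := hs (by omega)
    have h3 : φ (i + 1) ≤ φ j := hm (by omega)
    omega
  induction i using Int.induction_on with
  | zero => simp
  | succ i ih => rw [hstep, ih]; ring
  | pred i ih =>
    have := hstep (-(i : ℤ) - 1)
    rw [sub_add_cancel, ih] at this
    omega

section Numbering

variable {E : Type*} [PartialOrder E] [MeasurableSpace E] [MeasurableSingletonClass E]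

/-- A numbering is determined by its counting measure up to a translation of the indices. -/
theorem eq_comp_add_of_comb_eq {t t' : ℤ → E} (ht : StrictMono t) (ht' : Monotone t')
    (h : comb t' = comb t) : ∃ k : ℤ, ∀ i, t' i = t (i + k) := by
  have hr : ∀ j, ∃ i, t i = t' j := fun j => by
    rw [← comb_singleton_ne_zero_iff, ← h, comb_singleton_ne_zero_iff]
    exact ⟨j, rfl⟩
  choose φ hφ using hr
  have hm : Monotone φ := fun i j hij => by
    rw [← ht.le_iff_le, hφ, hφ]
    exact ht' hij
  have hinj : Function.Injective φ := fun i j hij => by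
    by_contra hne
    have hc : t' i = t' j := by rw [← hφ, ← hφ, hij]
    have h1 : comb t' {t' i} = 1 := by
      rw [h, ← hφ, comb_singleton_of_injective ht.injective]
    have h2 : ∑ l ∈ {i, j}, ({t' i} : Set E).indicator (1 : E → ℝ≥0∞) (t' l) ≤ 1 := by
      rw [← h1, comb_apply _ (measurableSet_singleton _)]
      exact ENNReal.sum_le_tsum _
    rw [Finset.sum_pair hne] at h2
    simp only [← hc, mem_singleton_iff, indicator_of_mem, Pi.one_apply] at h2
    norm_num at h2
  have hsurj : Function.Surjective φ := fun i => by
    have : ∃ j, t' j = t i := by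
      rw [← comb_singleton_ne_zero_iff, h, comb_singleton_ne_zero_iff]
      exact ⟨i, rfl⟩
    obtain ⟨j, hj⟩ := this
    exact ⟨j, ht.injective (by rw [hφ, hj])⟩
  exact ⟨φ 0, fun i => by rw [← hφ, int_eq_add_of_monotone_of_bijective hm ⟨hinj, hsurj⟩ i]⟩

theorem numbering_comb [Zero E] {π : E → ℝ} (hπ : Monotone π) {t : ℤ → E} (ht : StrictMono t)
    (h0 : π (t 0) ≤ 0) (h1 : 0 < π (t 1)) : numbering π (comb t) = t := by
  have hex : ∃ t', IsNumbering π (comb t) t' := ⟨t, ht.monotone, h0, h1, rfl⟩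
  rw [numbering, dif_pos hex]
  obtain ⟨hm, h0', h1', he⟩ := hex.choose_spec
  obtain ⟨k, hk⟩ := eq_comp_add_of_comb_eq ht hm he.symm
  have hmono : Monotone (π ∘ t) := hπ.comp ht.monotone
  have hk0 : k = 0 := by
    rw [hk] at h0' h1'
    have a1 : 0 + k < 1 := hmono.reflect_lt (h0'.trans_lt h1)
    have a2 : 0 < 1 + k := hmono.reflect_lt (h0.trans_lt h1')
    omega
  funext i
  rw [hk, hk0, add_zero]

end Numbering

/-! ### Recovering a sequence measurably from its counting measure -/

section Decoding

variable {E : Type*} [NormedAddCommGroup E] [MeasurableSpace E] [BorelSpace E]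
  [SecondCountableTopology E]

theorem IsCounting.measure_lt_top_of_isBounded {μ : Measure E} (h : IsCounting μ) {A : Set E}
    (hA : MeasurableSet A) (hb : Bornology.IsBounded A) : μ A < ∞ := by
  obtain ⟨n, hn⟩ := h A hA hb
  rw [hn]
  exact ENNReal.natCast_lt_top n

/-- Locally finite measures are separated by countably many evaluations, at the intersections of the
sets of a countable generating algebra with balls. -/
theorem exists_countable_evaluations (E : Type*) [NormedAddCommGroup E] [MeasurableSpace E]
    [BorelSpace E] [SecondCountableTopology E] :
    ∃ e : Measure E → ℕ → ℝ≥0∞, Measurable e ∧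
      ∀ μ ν : Measure E, (∀ n : ℕ, μ (Metric.ball 0 n) < ∞) → (∀ n : ℕ, ν (Metric.ball 0 n) < ∞) →
        e μ = e ν → μ = ν := by
  let b := TopologicalSpace.countableBasis E
  let C := generateSetAlgebra b
  have hCc : (C ×ˢ (univ : Set ℕ)).Countable :=
    (countable_generateSetAlgebra (TopologicalSpace.countable_countableBasis E)).prod
      countable_univ
  have halg : IsSetAlgebra C := isSetAlgebra_generateSetAlgebra
  have hgen : ‹MeasurableSpace E› = MeasurableSpace.generateFrom C := by
    rw [generateFrom_generateSetAlgebra_eq, BorelSpace.measurable_eq (α := E)]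
    exact (TopologicalSpace.isBasis_countableBasis E).borel_eq_generateFrom
  have hCm : ∀ A ∈ C, MeasurableSet A := fun A hA => by
    rw [hgen]
    exact MeasurableSpace.measurableSet_generateFrom hA
  have hne : (C ×ˢ (univ : Set ℕ)).Nonempty := ⟨(∅, 0), halg.empty_mem, trivial⟩
  obtain ⟨f, hf⟩ := hCc.exists_eq_range hne
  have hfC : ∀ k, (f k).1 ∈ C := fun k => by
    have : f k ∈ C ×ˢ (univ : Set ℕ) := hf ▸ mem_range_self k
    exact this.1
  refine ⟨fun μ k => μ ((f k).1 ∩ Metric.ball 0 (f k).2), measurable_pi_lambda _ fun k =>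
    Measure.measurable_coe ((hCm _ (hfC k)).inter Metric.isOpen_ball.measurableSet),
    fun μ ν hμ hν he => ?_⟩
  have heq : ∀ A ∈ C, ∀ n : ℕ, μ (A ∩ Metric.ball 0 n) = ν (A ∩ Metric.ball 0 n) := by
    intro A hA n
    have : (A, n) ∈ range f := hf ▸ ⟨hA, trivial⟩
    obtain ⟨k, hk⟩ := this
    have := congrFun he k
    simpa [hk] using this
  refine (Measure.ext_iff_of_iUnion_eq_univ (Metric.iUnion_ball_nat (0 : E))).2 fun n => ?_
  have : IsFiniteMeasure (μ.restrict (Metric.ball 0 n)) := ⟨by simpa using hμ n⟩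
  refine ext_of_generate_finite C hgen
    (fun s hs t ht _ => halg.inter_mem hs ht) (fun A hA => ?_) ?_
  · rw [Measure.restrict_apply (hCm A hA), Measure.restrict_apply (hCm A hA), heq A hA n]
  · have := heq univ halg.univ_mem n
    rw [univ_inter] at this
    simpa using this

/-- By the Lusin–Souslin theorem, an injective measurable family of locally finite measures that is
parametrized by a Borel subset of a standard Borel space has a measurable range and a measurable
inverse. -/
theorem exists_measurable_decoding {X : Type*} [MeasurableSpace X] [StandardBorelSpace X]
    [Nonempty X] {T : Set X} (hT : MeasurableSet T) {c : X → Measure E} (hc : Measurable c)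
    (hfin : ∀ u ∈ T, ∀ n : ℕ, c u (Metric.ball 0 n) < ∞) (hinj : InjOn c T) :
    MeasurableSet (c '' T) ∧ ∃ κ : Measure E → X, Measurable κ ∧ ∀ u ∈ T, κ (c u) = u := by
  obtain ⟨e, he, heinj⟩ := exists_countable_evaluations E
  have hec : Measurable fun u => e (c u) := he.comp hc
  have hecinj : InjOn (fun u => e (c u)) T := fun u hu v hv huv =>
    hinj hu hv (heinj _ _ (hfin u hu) (hfin v hv) huv)
  constructor
  · have h1 : MeasurableSet ((fun u => e (c u)) '' T) := hT.image_of_measurable_injOn hec hecinj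
    have h2 : MeasurableSet (⋂ n : ℕ, {μ : Measure E | μ (Metric.ball 0 n) < ∞}) :=
      MeasurableSet.iInter fun n =>
        Measure.measurable_coe Metric.isOpen_ball.measurableSet measurableSet_Iio
    have h3 : c '' T =
        (⋂ n : ℕ, {μ : Measure E | μ (Metric.ball 0 n) < ∞}) ∩
          e ⁻¹' ((fun u => e (c u)) '' T) := by
      ext μ
      constructor
      · rintro ⟨u, hu, rfl⟩
        exact ⟨mem_iInter.2 (hfin u hu), u, hu, rfl⟩
      · rintro ⟨hμ, u, hu, h⟩
        exact ⟨u, hu, heinj _ _ (hfin u hu) (fun n => mem_iInter.1 hμ n) h⟩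
    rw [h3]
    exact h2.inter (he h1)
  · have : StandardBorelSpace T := hT.standardBorel
    have hemb : MeasurableEmbedding fun u : T => e (c u) :=
      (hec.comp measurable_subtype_coe).measurableEmbedding
        fun u v huv => Subtype.ext (hecinj u.2 v.2 huv)
    obtain ⟨g, hg, hgc⟩ := hemb.exists_measurable_extend (g := Subtype.val)
      measurable_subtype_coe fun _ => inferInstance
    exact ⟨g ∘ e, hg.comp he, fun u hu => congrFun hgc ⟨u, hu⟩⟩

end Decoding

theorem existsUnique_le_lt {p : ℤ → ℝ} (hp : StrictMono p) (hr : ∀ x, ∃ i, x ≤ p i)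
    (hl : ∀ x, ∃ i, p i ≤ x) (c : ℝ) : ∃ i, p i ≤ c ∧ c < p (i + 1) ∧
      ∀ j, p j ≤ c → c < p (j + 1) → j = i := by
  obtain ⟨i, hi, hmax⟩ := Int.exists_greatest_of_bdd (P := fun i => p i ≤ c)
    (by
      obtain ⟨b, hb⟩ := hr c
      exact ⟨b, fun z hz => hp.le_iff_le.1 (hz.trans hb)⟩) (hl c)
  have h1 : c < p (i + 1) := by
    by_contra hc
    have := hmax _ (not_lt.1 hc)
    omega
  refine ⟨i, hi, h1, fun j hj hj1 => ?_⟩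
  have a1 : j < i + 1 := hp.lt_iff_lt.1 (hj.trans_lt h1)
  have a2 : i < j + 1 := hp.lt_iff_lt.1 (hi.trans_lt hj1)
  omega

/-! ### Configurations parametrized by their gaps -/

/-- A parametrization of configurations with a point at the origin by sequences of gaps. For `u` in
the set `T` of regular parameters, `pts u` enumerates the points in increasing order, with
`pts u 0 = 0`; re-rooting the configuration at the point number `k` corresponds to `σ k`. The points
are numbered with respect to the coordinate `π`. -/
structure GapModel (E X : Type*) [NormedAddCommGroup E] [PartialOrder E] [MeasurableSpace E]
    [MeasurableSpace X] where
  T : Set X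
  pts : X → ℤ → E
  σ : ℤ → X → X
  π : E →+ ℝ
  measurableSet_T : MeasurableSet T
  measurable_pts : ∀ i, Measurable fun u => pts u i
  measurable_σ : ∀ k, Measurable (σ k)
  measurable_π : Measurable π
  monotone_π : Monotone π
  abs_π_le : ∀ x, |π x| ≤ ‖x‖
  pts_zero : ∀ u, pts u 0 = 0
  pts_σ : ∀ u k i, pts (σ k u) i = pts u (i + k) - pts u k
  σ_mem : ∀ k, ∀ u ∈ T, σ k u ∈ T
  strictMono_pts : ∀ u ∈ T, StrictMono (pts u)
  strictMono_π : ∀ u ∈ T, StrictMono fun i => π (pts u i)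
  exists_ge : ∀ u ∈ T, ∀ x : ℝ, ∃ i, x ≤ π (pts u i)
  exists_le : ∀ u ∈ T, ∀ x : ℝ, ∃ i, π (pts u i) ≤ x
  injOn : ∀ u ∈ T, ∀ v ∈ T, pts u = pts v → u = v

namespace GapModel

section Basic

variable {E X : Type*} [NormedAddCommGroup E] [PartialOrder E] [MeasurableSpace E] [BorelSpace E]
  [SecondCountableTopology E] [MeasurableSpace X] (M : GapModel E X)

theorem isCounting {u : X} (hu : u ∈ M.T) : IsCounting (comb (M.pts u)) := by
  refine isCounting_comb fun R => ?_
  obtain ⟨a, ha⟩ := M.exists_le u hu (-R - 1)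
  obtain ⟨b, hb⟩ := M.exists_ge u hu (R + 1)
  refine (finite_Icc a b).subset fun i hi => ?_
  have h1 := abs_le.1 ((M.abs_π_le _).trans hi)
  exact ⟨(M.strictMono_π u hu).le_iff_le.1 (by linarith),
    (M.strictMono_π u hu).le_iff_le.1 (by linarith)⟩

theorem measurable_comb : Measurable fun u => comb (M.pts u) := by
  refine Measure.measurable_of_measurable_coe _ fun A hA => ?_
  simp only [comb_apply _ hA]
  exact Measurable.tsum fun i => (measurable_one.indicator hA).comp (M.measurable_pts i)

theorem numbering_eq {u : X} (hu : u ∈ M.T) {z : E} (h0 : M.π z ≤ 0)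
    (h1 : 0 < M.π (M.pts u 1) + M.π z) [IsOrderedAddMonoid E] :
    numbering M.π (comb fun i => M.pts u i + z) = fun i => M.pts u i + z := by
  refine numbering_comb M.monotone_π (fun i j hij => ?_) ?_ ?_
  · simpa using M.strictMono_pts u hu hij
  · simpa [M.pts_zero] using h0
  · simpa using h1

theorem injOn_comb : InjOn (fun u => comb (M.pts u)) M.T := by
  intro u hu v hv huv
  refine M.injOn u hu v hv ?_
  have key : ∀ w ∈ M.T, numbering M.π (comb (M.pts w)) = M.pts w := fun w hw => by
    refine numbering_comb M.monotone_π (M.strictMono_pts w hw) ?_ ?_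
    · simp [M.pts_zero]
    · have := M.strictMono_π w hw zero_lt_one
      simpa [M.pts_zero] using this
  rw [← key u hu, ← key v hv]
  exact congrArg _ huv

/-- The counting measures of the regular parameters. -/
def good : Set (Measure E) := (fun u => comb (M.pts u)) '' M.T

variable [StandardBorelSpace X] [Nonempty X]

theorem exists_decoding : MeasurableSet M.good ∧
    ∃ κ : Measure E → X, Measurable κ ∧ ∀ u ∈ M.T, κ (comb (M.pts u)) = u :=
  exists_measurable_decoding M.measurableSet_T M.measurable_comb
    (fun _ hu _ => (M.isCounting hu).measure_lt_top_of_isBounded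
      Metric.isOpen_ball.measurableSet Metric.isBounded_ball) M.injOn_comb

theorem measurableSet_good : MeasurableSet M.good := M.exists_decoding.1

/-- The parameter of a counting measure, a measurable function with arbitrary values outside
`good`. -/
def gaps : Measure E → X := M.exists_decoding.2.choose

theorem measurable_gaps : Measurable M.gaps := M.exists_decoding.2.choose_spec.1

theorem gaps_comb {u : X} (hu : u ∈ M.T) : M.gaps (comb (M.pts u)) = u :=
  M.exists_decoding.2.choose_spec.2 u hu

open Classical in
/-- The configuration with parameter `u`, empty if `u` is not regular. -/
def config (u : X) : Config E :=
  if hu : u ∈ M.T then ⟨comb (M.pts u), M.isCounting hu⟩ else ⟨0, fun _ _ _ => ⟨0, by simp⟩⟩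

theorem config_val {u : X} (hu : u ∈ M.T) : (M.config u).1 = comb (M.pts u) := by
  rw [config, dif_pos hu]

theorem measurable_config : Measurable M.config := by
  classical
  have h : Measurable fun u => if u ∈ M.T then comb (M.pts u) else 0 :=
    Measurable.ite M.measurableSet_T M.measurable_comb measurable_const
  refine Measurable.of_comap_le ?_
  have : (fun u => if u ∈ M.T then comb (M.pts u) else 0) = Subtype.val ∘ M.config := by
    funext u
    by_cases hu : u ∈ M.T <;> simp [config, hu]
  rw [this] at h
  rw [Subtype.instMeasurableSpace, MeasurableSpace.comap_comp]
  exact h.comap_le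

theorem gaps_config {u : X} (hu : u ∈ M.T) : M.gaps (M.config u).1 = u := by
  rw [M.config_val hu, M.gaps_comb hu]

theorem config_mem_good {u : X} (hu : u ∈ M.T) : (M.config u).1 ∈ M.good :=
  ⟨u, hu, (M.config_val hu).symm⟩

theorem gaps_mem {μ : Measure E} (h : μ ∈ M.good) : M.gaps μ ∈ M.T := by
  obtain ⟨u, hu, rfl⟩ := h
  simpa only [M.gaps_comb hu] using hu

theorem comb_gaps {μ : Measure E} (h : μ ∈ M.good) : comb (M.pts (M.gaps μ)) = μ := by
  obtain ⟨u, hu, rfl⟩ := h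
  simp only [M.gaps_comb hu]

theorem config_gaps {ξ : Config E} (h : ξ.1 ∈ M.good) : M.config (M.gaps ξ.1) = ξ :=
  Subtype.ext (by rw [M.config_val (M.gaps_mem h), M.comb_gaps h])

theorem lintegral_config {u : X} (hu : u ∈ M.T) (f : E → ℝ≥0∞) :
    ∫⁻ x, f x ∂(M.config u).1 = ∑' i, f (M.pts u i) := by
  rw [M.config_val hu, lintegral_comb]

end Basic

section Measures

variable {E X : Type*} [NormedAddCommGroup E] [PartialOrder E] [MeasureSpace E] [BorelSpace E]
  [SecondCountableTopology E] [MeasurableSpace X] [StandardBorelSpace X] [Nonempty X]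
  (M : GapModel E X)

theorem shift_neg_config_val {u : X} (hu : u ∈ M.T) (z : E) :
    (shift (-z) (M.config u)).1 = comb fun i => M.pts u i + z := by
  simp only [shift]
  rw [M.config_val hu, map_comb (by fun_prop)]
  simp [Function.comp_def]

theorem shift_config {u : X} (hu : u ∈ M.T) (k : ℤ) :
    shift (M.pts u k) (M.config u) = M.config (M.σ k u) := by
  refine Subtype.ext ?_
  simp only [shift]
  rw [M.config_val hu, M.config_val (M.σ_mem k u hu), map_comb (by fun_prop),
    ← comb_comp_equiv _ (Equiv.addRight k)]
  congr 1
  funext i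
  simp [M.pts_σ]

theorem map_config_map_gaps {V : Measure (Config E)} (hV : ∀ᵐ ξ ∂V, ξ.1 ∈ M.good) :
    (V.map fun ξ => M.gaps ξ.1).map M.config = V := by
  have hg : Measurable fun ξ : Config E => M.gaps ξ.1 :=
    M.measurable_gaps.comp measurable_subtype_coe
  rw [Measure.map_map M.measurable_config hg]
  conv_rhs => rw [← Measure.map_id (μ := V)]
  refine Measure.map_congr ?_
  filter_upwards [hV] with ξ hξ
  exact M.config_gaps hξ

theorem map_gaps_map_config {U : Measure X} (hU : ∀ᵐ u ∂U, u ∈ M.T) :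
    (U.map M.config).map (fun ξ => M.gaps ξ.1) = U := by
  have hg : Measurable fun ξ : Config E => M.gaps ξ.1 :=
    M.measurable_gaps.comp measurable_subtype_coe
  rw [Measure.map_map hg M.measurable_config]
  conv_rhs => rw [← Measure.map_id (μ := U)]
  refine Measure.map_congr ?_
  filter_upwards [hU] with u hu
  exact M.gaps_config hu

theorem ae_map_config {U : Measure X} (hU : ∀ᵐ u ∂U, u ∈ M.T) :
    ∀ᵐ ξ ∂(U.map M.config), ξ.1 ∈ M.good := by
  rw [ae_map_iff M.measurable_config.aemeasurable
    (measurable_subtype_coe M.measurableSet_good)]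
  filter_upwards [hU] with u hu
  exact M.config_mem_good hu

/-- The gaps of a point-stationary configuration form a stationary sequence: in the exchange
formula, let `y` be the point number `-k`. -/
theorem map_σ_map_gaps {V : Measure (Config E)} (hs : IsPointStationary V)
    (hV : ∀ᵐ ξ ∂V, ξ.1 ∈ M.good) (k : ℤ) :
    (V.map fun ξ => M.gaps ξ.1).map (M.σ k) = V.map fun ξ => M.gaps ξ.1 := by
  classical
  have hg : Measurable fun ξ : Config E => M.gaps ξ.1 :=
    M.measurable_gaps.comp measurable_subtype_coe
  ext A hA
  have h1A : Measurable (A.indicator (1 : X → ℝ≥0∞)) := measurable_one.indicator hA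
  let D : Set (Config E × E) := {q | q.2 = M.pts (M.gaps q.1.1) (-k)}
  have hD : MeasurableSet D := by
    have hp : Measurable fun q : Config E × E => M.pts (M.gaps q.1.1) (-k) :=
      (M.measurable_pts (-k)).comp (hg.comp measurable_fst)
    have : D = (fun q : Config E × E => q.2 - M.pts (M.gaps q.1.1) (-k)) ⁻¹' {0} := by
      ext q
      simp [D, sub_eq_zero]
    rw [this]
    exact (measurable_snd.sub hp) (measurableSet_singleton 0)
  let g : Config E × E → ℝ≥0∞ := fun q => D.indicator 1 q * A.indicator 1 (M.gaps q.1.1)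
  have hgm : Measurable g :=
    (measurable_one.indicator hD).mul (h1A.comp (hg.comp measurable_fst))
  have h := hs g hgm
  rw [← lintegral_indicator_one hA, ← lintegral_indicator_one hA,
    lintegral_map h1A (M.measurable_σ k),
    lintegral_map (f := fun u => A.indicator 1 (M.σ k u)) (h1A.comp (M.measurable_σ k)) hg,
    lintegral_map h1A hg]
  have e1 : ∫⁻ ξ, ∫⁻ y, g (ξ, y) ∂ξ.1 ∂V = ∫⁻ ξ, A.indicator 1 (M.gaps ξ.1) ∂V := by
    refine lintegral_congr_ae ?_
    filter_upwards [hV] with ξ hξ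
    obtain ⟨u, hu, rfl⟩ : ∃ u ∈ M.T, M.config u = ξ := ⟨_, M.gaps_mem hξ, M.config_gaps hξ⟩
    rw [M.lintegral_config hu, tsum_eq_single (-k)]
    · simp [g, D, M.gaps_config hu]
    · intro i hi
      have : M.pts u i ≠ M.pts u (-k) := (M.strictMono_pts u hu).injective.ne hi
      simp [g, D, M.gaps_config hu, this]
  have e2 : ∫⁻ ξ, ∫⁻ y, g (shift y ξ, -y) ∂ξ.1 ∂V =
      ∫⁻ ξ, A.indicator 1 (M.σ k (M.gaps ξ.1)) ∂V := by
    refine lintegral_congr_ae ?_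
    filter_upwards [hV] with ξ hξ
    obtain ⟨u, hu, rfl⟩ : ∃ u ∈ M.T, M.config u = ξ := ⟨_, M.gaps_mem hξ, M.config_gaps hξ⟩
    have hpt : ∀ i, -M.pts u i = M.pts (M.σ i u) (-k) ↔ i = k := fun i => by
      rw [M.pts_σ, eq_comm, sub_eq_neg_self, ← M.pts_zero u,
        (M.strictMono_pts u hu).injective.eq_iff]
      omega
    rw [M.lintegral_config hu, tsum_eq_single k]
    · simp [g, D, M.shift_config hu, M.gaps_config (M.σ_mem _ u hu), M.gaps_config hu,
        (hpt k).2 rfl]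
    · intro i hi
      have : -M.pts u i ≠ M.pts (M.σ i u) (-k) := fun h => hi ((hpt i).1 h)
      simp [g, D, M.shift_config hu, M.gaps_config (M.σ_mem _ u hu), this]
  rw [← e1, ← e2, h]

theorem isPointStationary_map_config {U : Measure X} (hU : ∀ᵐ u ∂U, u ∈ M.T)
    (hs : ∀ k, U.map (M.σ k) = U) : IsPointStationary (U.map M.config) := by
  intro g hg
  have hm1 : Measurable fun ξ : Config E => ∫⁻ y, g (ξ, y) ∂ξ.1 :=
    measurable_lintegral_config measurable_id (F := fun ξ y => g (ξ, y)) hg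
  have hm2 : Measurable fun ξ : Config E => ∫⁻ y, g (shift y ξ, -y) ∂ξ.1 :=
    measurable_lintegral_config measurable_id (F := fun ξ y => g (shift y ξ, -y))
      (hg.comp (measurable_shift.prodMk measurable_snd.neg))
  have hm3 : ∀ i, Measurable fun u => g (M.config u, M.pts u i) := fun i =>
    hg.comp (M.measurable_config.prodMk (M.measurable_pts i))
  rw [lintegral_map hm1 M.measurable_config, lintegral_map hm2 M.measurable_config]
  have e1 : ∫⁻ u, ∫⁻ y, g (M.config u, y) ∂(M.config u).1 ∂U =
      ∑' i, ∫⁻ u, g (M.config u, M.pts u i) ∂U := by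
    rw [← lintegral_tsum fun i => (hm3 i).aemeasurable]
    refine lintegral_congr_ae ?_
    filter_upwards [hU] with u hu
    rw [M.lintegral_config hu]
  have e2 : ∫⁻ u, ∫⁻ y, g (shift y (M.config u), -y) ∂(M.config u).1 ∂U =
      ∑' i, ∫⁻ u, g (M.config (M.σ i u), M.pts (M.σ i u) (-i)) ∂U := by
    have hm4 : ∀ i, Measurable fun u => g (M.config (M.σ i u), M.pts (M.σ i u) (-i)) := fun i =>
      (hm3 (-i)).comp (M.measurable_σ i)
    rw [← lintegral_tsum fun i => (hm4 i).aemeasurable]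
    refine lintegral_congr_ae ?_
    filter_upwards [hU] with u hu
    rw [M.lintegral_config hu]
    refine tsum_congr fun i => ?_
    rw [M.shift_config hu, M.pts_σ, neg_add_cancel, M.pts_zero, zero_sub]
  rw [e1, e2, ← (Equiv.neg ℤ).tsum_eq]
  refine tsum_congr fun i => ?_
  rw [Equiv.neg_apply]
  conv_lhs => rw [← hs i]
  exact lintegral_map (hm3 (-i)) (M.measurable_σ i)

/-- The weight that selects, in a translate of the configuration `ξ`, the point number zero: if the
origin is moved to `z`, then it becomes the last point with nonpositive coordinate `π`. -/
def weight (q : Config E × E) : ℝ≥0∞ :=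
  {q : Config E × E | M.π q.2 ≤ 0 ∧ 0 < M.π (M.pts (M.gaps q.1.1) 1) + M.π q.2}.indicator 1 q

theorem weight_le_one (q : Config E × E) : M.weight q ≤ 1 :=
  indicator_le_self' (fun _ _ => zero_le) q

theorem measurable_weight : Measurable M.weight := by
  have h2 : Measurable fun q : Config E × E => M.π q.2 := M.measurable_π.comp measurable_snd
  have h1 : Measurable fun q : Config E × E => M.π (M.pts (M.gaps q.1.1) 1) :=
    M.measurable_π.comp ((M.measurable_pts 1).comp
      (M.measurable_gaps.comp (measurable_subtype_coe.comp measurable_fst)))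
  exact measurable_one.indicator ((measurableSet_le h2 measurable_const).inter
    (measurableSet_lt measurable_const (h1.add h2)))

theorem existsUnique_index {u : X} (hu : u ∈ M.T) (a : E) :
    ∃ i, M.π (M.pts u i + a) ≤ 0 ∧ 0 < M.π (M.pts u (i + 1) + a) ∧
      ∀ j, M.π (M.pts u j + a) ≤ 0 → 0 < M.π (M.pts u (j + 1) + a) → j = i := by
  obtain ⟨i, h1, h2, h3⟩ := existsUnique_le_lt (M.strictMono_π u hu) (M.exists_ge u hu)
    (M.exists_le u hu) (-M.π a)
  simp only [map_add]
  exact ⟨i, by linarith, by linarith, fun j hj hj' => h3 j (by linarith) (by linarith)⟩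

theorem isUnitWeight_weight {ξ : Config E} (hξ : ξ.1 ∈ M.good) : IsUnitWeight M.weight ξ := by
  obtain ⟨u, hu, rfl⟩ : ∃ u ∈ M.T, M.config u = ξ := ⟨_, M.gaps_mem hξ, M.config_gaps hξ⟩
  intro a
  have key : ∀ i, M.weight (shift (M.pts u i) (M.config u), M.pts u i + a) =
      {i | M.π (M.pts u i + a) ≤ 0 ∧ 0 < M.π (M.pts u (i + 1) + a)}.indicator 1 i := fun i => by
    rw [M.shift_config hu, weight]
    refine indicator_eq_indicator ?_ rfl
    simp only [mem_ofPred_eq, M.gaps_config (M.σ_mem i u hu), M.pts_σ, map_add, map_sub]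
    rw [add_comm 1 i, ← add_assoc (_ - _), sub_add_cancel]
  obtain ⟨i, h1, h2, h3⟩ := M.existsUnique_index hu a
  rw [M.lintegral_config hu, tsum_eq_single i]
  · rw [key, indicator_of_mem (by exact ⟨h1, h2⟩), Pi.one_apply]
  · intro j hj
    rw [key, indicator_of_notMem fun h => hj (h3 j h.1 h.2)]

theorem ae_isUnitWeight {Q V : Measure (Config E)} (h : HasPalm Q V)
    (hV : ∀ᵐ ξ ∂V, ξ.1 ∈ M.good) (h0 : ∀ᵐ ξ ∂Q, ξ.1 ≠ 0) :
    ∀ᵐ ξ ∂Q, IsUnitWeight M.weight ξ :=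
  h.ae_of_ae_palm_of_ne_zero (fun z _ hξ => hξ.shift z)
    (hV.mono fun _ hξ => M.isUnitWeight_weight hξ) h0

/-- The Palm measure determines `Q` if `Q` does not charge the empty configuration. -/
theorem hasPalm_unique {Q Q' V : Measure (Config E)} (h : HasPalm Q V) (h' : HasPalm Q' V)
    (hV : ∀ᵐ ξ ∂V, ξ.1 ∈ M.good) (h0 : ∀ᵐ ξ ∂Q, ξ.1 ≠ 0) (h0' : ∀ᵐ ξ ∂Q', ξ.1 ≠ 0) : Q = Q' :=
  h.unique h' M.measurable_weight (M.ae_isUnitWeight h hV h0) (M.ae_isUnitWeight h' hV h0')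

/-- A stationary law of regular gaps is the law of the gaps under the Palm measure of a stationary
measure. -/
theorem exists_hasPalm [(volume : Measure E).IsAddHaarMeasure] [ProperSpace E] {U : Measure X}
    [IsFiniteMeasure U] (hU : ∀ᵐ u ∂U, u ∈ M.T) (hs : ∀ k, U.map (M.σ k) = U) :
    ∃ Q : Measure (Config E), SigmaFinite Q ∧ Stationary Q ∧ (∀ᵐ ξ ∂Q, ξ.1 ≠ 0) ∧
      HasPalm Q (U.map M.config) := by
  have hst := M.isPointStationary_map_config hU hs
  have hu : ∀ᵐ ξ ∂(U.map M.config), IsUnitWeight M.weight ξ :=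
    (M.ae_map_config hU).mono fun _ hξ => M.isUnitWeight_weight hξ
  exact ⟨palmInverse M.weight (U.map M.config),
    sigmaFinite_palmInverse hst M.measurable_weight M.weight_le_one hu,
    stationary_palmInverse hst M.measurable_weight hu,
    ae_ne_zero_palmInverse M.measurable_weight hu,
    hasPalm_palmInverse hst M.measurable_weight hu⟩

/-- Almost every configuration is a translate of a configuration with regular gaps, rooted at its
last point with nonpositive coordinate `π`. -/
theorem ae_exists_eq_shift_config {Q V : Measure (Config E)} (h : HasPalm Q V)
    (hV : ∀ᵐ ξ ∂V, ξ.1 ∈ M.good) (h0 : ∀ᵐ ξ ∂Q, ξ.1 ≠ 0) :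
    ∀ᵐ ξ ∂Q, ∃ u ∈ M.T, ∃ z, M.π z ≤ 0 ∧ 0 < M.π (M.pts u 1) + M.π z ∧
      ξ = shift (-z) (M.config u) := by
  have h1 : ∀ᵐ ξ ∂Q, ∃ u ∈ M.T, ∃ z, ξ = shift (-z) (M.config u) := by
    refine h.ae_of_ae_palm_of_ne_zero ?_ (hV.mono fun ξ hξ => ?_) h0
    · rintro x _ ⟨u, hu, z, rfl⟩
      exact ⟨u, hu, z - x, by rw [shift_shift, neg_sub, sub_eq_add_neg]⟩
    · exact ⟨_, M.gaps_mem hξ, 0, by rw [neg_zero, shift_zero, M.config_gaps hξ]⟩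
  filter_upwards [h1] with ξ hξ
  obtain ⟨u, hu, z, rfl⟩ := hξ
  obtain ⟨i, hi1, hi2, -⟩ := M.existsUnique_index hu z
  refine ⟨M.σ i u, M.σ_mem i u hu, M.pts u i + z, hi1, ?_, ?_⟩
  · rw [M.pts_σ, ← map_add, add_comm 1 i, ← add_assoc, sub_add_cancel]
    exact hi2
  · rw [← M.shift_config hu, shift_shift]
    congr 1
    abel

end Measures

end GapModel

/-! ### The parametrizations of configurations on the line and in the plane -/

/-- The position of the point number `i` if the point number zero is the origin and the gap before
the point number `k` is `s k`. -/
def psum (s : GapSeq) (i : ℤ) : ℝ :=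
  ∑ k ∈ Finset.Ioc 0 i, (s k : ℝ) - ∑ k ∈ Finset.Ioc i 0, (s k : ℝ)

@[simp]
theorem psum_zero (s : GapSeq) : psum s 0 = 0 := by simp [psum]

theorem psum_succ (s : GapSeq) (i : ℤ) : psum s (i + 1) = psum s i + s (i + 1) := by
  rcases le_or_gt 0 i with hi | hi
  · have h1 : Finset.Ioc 0 (i + 1) = insert (i + 1) (Finset.Ioc 0 i) := by
      ext k
      simp only [Finset.mem_Ioc, Finset.mem_insert]
      omega
    rw [psum, psum, h1, Finset.sum_insert (by simp), Finset.Ioc_eq_empty (by omega : ¬ i < 0),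
      Finset.Ioc_eq_empty (by omega : ¬ i + 1 < 0)]
    simp [add_comm]
  · have h1 : Finset.Ioc i 0 = insert (i + 1) (Finset.Ioc (i + 1) 0) := by
      ext k
      simp only [Finset.mem_Ioc, Finset.mem_insert]
      omega
    rw [psum, psum, h1, Finset.sum_insert (by simp), Finset.Ioc_eq_empty (by omega : ¬ 0 < i),
      Finset.Ioc_eq_empty (by omega : ¬ 0 < i + 1)]
    simp

theorem eq_psum {s : GapSeq} {t : ℤ → ℝ} (h0 : t 0 = 0)
    (h : ∀ i, t (i + 1) = t i + s (i + 1)) : t = psum s := by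
  funext i
  induction i using Int.induction_on with
  | zero => simp [h0]
  | succ i ih => rw [h, psum_succ, ih]
  | pred i ih =>
    have h1 := h (-(i : ℤ) - 1)
    have h2 := psum_succ s (-(i : ℤ) - 1)
    rw [sub_add_cancel] at h1 h2
    linarith

theorem psum_seqShift (s : GapSeq) (k i : ℤ) :
    psum (seqShift k s) i = psum s (i + k) - psum s k := by
  have : (fun i => psum s (i + k) - psum s k) = psum (seqShift k s) := by
    refine eq_psum (by simp) fun i => ?_
    rw [show i + 1 + k = i + k + 1 by ring, psum_succ, seqShift, show i + 1 + k = i + k + 1 by ring]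
    ring
  exact (congrFun this i).symm

theorem psum_sub_psum (s : GapSeq) (i : ℤ) : psum s i - psum s (i - 1) = s i := by
  have := psum_succ s (i - 1)
  rw [sub_add_cancel] at this
  linarith

theorem measurable_psum (i : ℤ) : Measurable fun s => psum s i := by
  unfold psum
  fun_prop

theorem measurable_seqShift (k : ℤ) : Measurable (seqShift k) :=
  measurable_pi_lambda _ fun i => measurable_pi_apply (i + k)

/-- The sequences of positive gaps whose sums in both directions are infinite. -/
def regularGaps : Set GapSeq :=
  {s | (∀ i, 0 < s i) ∧ (∀ n : ℕ, ∃ i, (n : ℝ) ≤ psum s i) ∧ ∀ n : ℕ, ∃ i, psum s i ≤ -n}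

theorem measurableSet_regularGaps : MeasurableSet regularGaps := by
  have e : regularGaps = (⋂ i, {s | 0 < s i}) ∩
      ((⋂ n : ℕ, ⋃ i, {s | (n : ℝ) ≤ psum s i}) ∩ ⋂ n : ℕ, ⋃ i, {s | psum s i ≤ -n}) := by
    ext s
    simp [regularGaps]
  rw [e]
  exact (MeasurableSet.iInter fun i =>
      measurableSet_lt measurable_const (measurable_pi_apply i)).inter
    ((MeasurableSet.iInter fun n => MeasurableSet.iUnion fun i =>
      measurableSet_le measurable_const (measurable_psum i)).inter
    (MeasurableSet.iInter fun n => MeasurableSet.iUnion fun i =>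
      measurableSet_le (measurable_psum i) measurable_const))

theorem strictMono_psum {s : GapSeq} (hs : s ∈ regularGaps) : StrictMono (psum s) := by
  refine strictMono_int_of_lt_succ fun i => ?_
  rw [psum_succ]
  have : (0 : ℝ) < s (i + 1) := hs.1 _
  linarith

theorem exists_le_psum {s : GapSeq} (hs : s ∈ regularGaps) (x : ℝ) : ∃ i, x ≤ psum s i := by
  obtain ⟨n, hn⟩ := exists_nat_ge x
  obtain ⟨i, hi⟩ := hs.2.1 n
  exact ⟨i, hn.trans hi⟩

theorem exists_psum_le {s : GapSeq} (hs : s ∈ regularGaps) (x : ℝ) : ∃ i, psum s i ≤ x := by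
  obtain ⟨n, hn⟩ := exists_nat_ge (-x)
  obtain ⟨i, hi⟩ := hs.2.2 n
  exact ⟨i, by linarith⟩

theorem seqShift_mem {s : GapSeq} (hs : s ∈ regularGaps) (k : ℤ) :
    seqShift k s ∈ regularGaps := by
  refine ⟨fun i => hs.1 _, fun n => ?_, fun n => ?_⟩
  · obtain ⟨i, hi⟩ := exists_le_psum hs (n + psum s k)
    exact ⟨i - k, by rw [psum_seqShift, sub_add_cancel]; linarith⟩
  · obtain ⟨i, hi⟩ := exists_psum_le hs (-n + psum s k)
    exact ⟨i - k, by rw [psum_seqShift, sub_add_cancel]; linarith⟩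

theorem psum_injective {s s' : GapSeq} (h : psum s = psum s') : s = s' := by
  funext i
  have h1 := psum_sub_psum s i
  rw [h, psum_sub_psum] at h1
  exact_mod_cast h1.symm

/-- Configurations on the line, parametrized by their gaps. -/
def lineModel : GapModel ℝ GapSeq where
  T := regularGaps
  pts := psum
  σ := seqShift
  π := AddMonoidHom.id ℝ
  measurableSet_T := measurableSet_regularGaps
  measurable_pts := measurable_psum
  measurable_σ := measurable_seqShift
  measurable_π := measurable_id
  monotone_π := monotone_id
  abs_π_le := fun _ => le_rfl
  pts_zero := psum_zero
  pts_σ := psum_seqShift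
  σ_mem := fun k _ hs => seqShift_mem hs k
  strictMono_pts := fun _ hs => strictMono_psum hs
  strictMono_π := fun _ hs => strictMono_psum hs
  exists_ge := fun _ hs => exists_le_psum hs
  exists_le := fun _ hs => exists_psum_le hs
  injOn := fun _ _ _ _ h => psum_injective h

/-- Configurations in the plane that increase strictly in both coordinates, parametrized by the
gaps of their two projections. -/
def planeModel : GapModel (ℝ × ℝ) (GapSeq × GapSeq) where
  T := regularGaps ×ˢ regularGaps
  pts := fun u i => (psum u.1 i, psum u.2 i)
  σ := fun k => Prod.map (seqShift k) (seqShift k)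
  π := AddMonoidHom.fst ℝ ℝ
  measurableSet_T := measurableSet_regularGaps.prod measurableSet_regularGaps
  measurable_pts := fun i => ((measurable_psum i).comp measurable_fst).prodMk
    ((measurable_psum i).comp measurable_snd)
  measurable_σ := fun k => (measurable_seqShift k).prodMap (measurable_seqShift k)
  measurable_π := measurable_fst
  monotone_π := monotone_fst
  abs_π_le := fun x => norm_fst_le x
  pts_zero := by simp
  pts_σ := fun u k i => by simp [psum_seqShift]
  σ_mem := fun k _ hs => ⟨seqShift_mem hs.1 k, seqShift_mem hs.2 k⟩
  strictMono_pts := fun _ hs _ _ hij =>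
    Prod.mk_lt_mk.2 (Or.inl ⟨strictMono_psum hs.1 hij, (strictMono_psum hs.2 hij).le⟩)
  strictMono_π := fun _ hs => strictMono_psum hs.1
  exists_ge := fun _ hs => exists_le_psum hs.1
  exists_le := fun _ hs => exists_psum_le hs.1
  injOn := fun _ _ _ _ h => Prod.ext
    (psum_injective (funext fun i => congrArg Prod.fst (congrFun h i)))
    (psum_injective (funext fun i => congrArg Prod.snd (congrFun h i)))

theorem sq_comb_psum {s : GapSeq} (hs : s ∈ regularGaps) : sq (comb (psum s)) = s := by
  have h : tau (comb (psum s)) = psum s := by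
    refine numbering_comb monotone_id (strictMono_psum hs) (by simp) ?_
    simpa using strictMono_psum hs zero_lt_one
  funext i
  rw [sq, h, psum_sub_psum, Real.toNNReal_coe]

theorem sq_eq_gaps {μ : Measure ℝ} (h : μ ∈ lineModel.good) : sq μ = lineModel.gaps μ := by
  obtain ⟨s, hs, rfl⟩ := h
  exact (sq_comb_psum hs).trans (lineModel.gaps_comb hs).symm

/-! ### Palm measures of stationary simple point processes on the line -/

/-- Under the Palm measure the origin is a point of the configuration, as counting measures are
concentrated on their atoms. -/
theorem HasPalm.ae_zero_mem {E : Type*} [NormedAddCommGroup E] [MeasureSpace E] [BorelSpace E]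
    [SecondCountableTopology E] [(volume : Measure E).IsAddHaarMeasure] [ProperSpace E]
    {Q V : Measure (Config E)} (h : HasPalm Q V) : ∀ᵐ ξ ∂V, ξ.1 {0} ≠ 0 := by
  obtain ⟨k, hk, hk1⟩ := exists_measurable_lintegral_eq_one (E := E)
  let N : Set (Config E) := {ξ | ξ.1 {0} = 0}
  have hN : MeasurableSet N := ((Measure.measurable_coe (measurableSet_singleton 0)).comp
    measurable_subtype_coe) (measurableSet_singleton 0)
  have h1N : Measurable (N.indicator (1 : Config E → ℝ≥0∞)) := measurable_one.indicator hN
  have h1 := h (fun q => N.indicator 1 q.1 * k q.2)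
    ((h1N.comp measurable_fst).mul (hk.comp measurable_snd))
  have h2 : ∫⁻ ξ, ∫⁻ x, N.indicator 1 (shift x ξ) * k x ∂ξ.1 ∂Q = 0 := by
    rw [lintegral_congr (g := fun _ => 0), lintegral_zero]
    intro ξ
    rw [lintegral_congr_ae (g := fun _ => 0), lintegral_zero]
    filter_upwards [measure_eq_zero_iff_ae_notMem.1 ξ.2.measure_non_atoms] with x hx
    have : shift x ξ ∉ N := by
      simpa [N, shift_singleton] using hx
    simp [this]
  have h3 : ∀ ξ : Config E, ∫⁻ x, N.indicator 1 ξ * k x = N.indicator 1 ξ := fun ξ => by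
    rw [lintegral_const_mul _ hk, hk1, mul_one]
  simp only at h1
  rw [h2] at h1
  simp_rw [h3] at h1
  rw [lintegral_indicator_one hN, eq_comm] at h1
  exact measure_eq_zero_iff_ae_notMem.1 h1

theorem volume_window : volume window = 1 := by
  rw [window, Real.volume_Icc]
  norm_num

theorem IsStationaryUnit.isProbabilityMeasure_palmLine {P : Measure (Config ℝ)}
    (h : IsStationaryUnit P) : IsProbabilityMeasure (palmLine P) := by
  have := h.prob
  refine ⟨?_⟩
  rw [← lintegral_one, palmLine, lintegral_palm _ _ measurable_const, volume_window, inv_one,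
    one_mul]
  simpa using h.intensity

theorem IsStationaryUnit.hasPalm {P : Measure (Config ℝ)} (h : IsStationaryUnit P) :
    HasPalm P (palmLine P) := by
  have := h.prob
  have := h.isProbabilityMeasure_palmLine
  have : IsFiniteMeasure (palm window measurableSet_window P) :=
    inferInstanceAs (IsFiniteMeasure (palmLine P))
  refine hasPalm_palm h.stationary measurableSet_window ?_ ?_
  · rw [window, interior_Icc]
    exact ⟨0, by norm_num⟩
  · rw [volume_window]
    exact ENNReal.one_ne_top

/-- For `D = (0, ∞)` and `D = (-∞, 0)`, no point of the configuration is the last or the first one.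
Points `x` without a point in `x + D` are unique in a simple configuration, so their expected number
is at most one; by the Campbell formula it is zero or infinite. -/
theorem IsStationaryUnit.ae_ne_zero {P : Measure (Config ℝ)} (h : IsStationaryUnit P)
    {D : Set ℝ} (hD : MeasurableSet D) (hD' : ∀ z ≠ 0, z ∈ D ∨ -z ∈ D) :
    ∀ᵐ ξ ∂palmLine P, ∀ x, ξ.1 {x} ≠ 0 → (shift x ξ).1 D ≠ 0 := by
  have := h.prob
  let L : Set (Config ℝ) := {ξ | ξ.1 D = 0}
  have hL : MeasurableSet L := ((Measure.measurable_coe hD).comp measurable_subtype_coe)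
    (measurableSet_singleton 0)
  have h1L : Measurable (L.indicator (1 : Config ℝ → ℝ≥0∞)) := measurable_one.indicator hL
  have hc := h.hasPalm (fun q => L.indicator 1 q.1) (h1L.comp measurable_fst)
  have hle : ∫⁻ ξ, ∫⁻ x, L.indicator 1 (shift x ξ) ∂ξ.1 ∂P ≤ 1 := by
    calc ∫⁻ ξ, ∫⁻ x, L.indicator 1 (shift x ξ) ∂ξ.1 ∂P ≤ ∫⁻ ξ, 1 ∂P := by
          refine lintegral_mono_ae ?_
          filter_upwards [h.simple] with ξ hξ
          let A : Set ℝ := {x | shift x ξ ∈ L}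
          have hA : MeasurableSet A :=
            (measurable_shift_comp (ξ := fun _ => ξ) measurable_id measurable_const) hL
          have e : ∫⁻ x, L.indicator 1 (shift x ξ) ∂ξ.1 = ξ.1 A := by
            rw [← lintegral_indicator_one hA]
            rfl
          rw [e]
          by_cases hA0 : ξ.1 A = 0
          · rw [hA0]
            exact zero_le
          obtain ⟨x, hxA, hx⟩ := ξ.2.exists_atom hA0
          have hdisj : ∀ y z, ξ.1 {z} ≠ 0 → y ∈ A → z - y ∉ D := fun y z hz hy hzy => by
            have hy' : (shift y ξ).1 D = 0 := hy
            rw [shift_apply] at hy'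
            exact hz (measure_mono_null (singleton_subset_iff.2 hzy) hy')
          have hsub : A ⊆ {x} ∪ {y | ξ.1 {y} = 0} := fun y hy => by
            by_contra hcon
            simp only [mem_union, mem_singleton_iff, mem_ofPred_eq, not_or] at hcon
            rcases hD' (x - y) (sub_ne_zero.2 (Ne.symm hcon.1)) with hd | hd
            · exact hdisj y x hx hy hd
            · exact hdisj x y hcon.2 hxA (by simpa using hd)
          calc ξ.1 A ≤ ξ.1 ({x} ∪ {y | ξ.1 {y} = 0}) := measure_mono hsub
            _ ≤ ξ.1 {x} + ξ.1 {y | ξ.1 {y} = 0} := measure_union_le _ _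
            _ = 1 := by rw [ξ.2.measure_non_atoms, add_zero, (hξ x).resolve_left hx]
      _ = 1 := by simp
  have hL0 : palmLine P L = 0 := by
    by_contra hne
    simp only at hc
    rw [hc] at hle
    simp only [lintegral_const, Real.volume_univ] at hle
    rw [lintegral_mul_const _ h1L, lintegral_indicator_one hL, ENNReal.mul_top hne] at hle
    simp at hle
  refine h.hasPalm.ae_palm_of_ae (fun x ξ hξ y hy => ?_) ?_
  · rw [shift_shift]
    rw [shift_singleton] at hy
    exact hξ _ hy
  · filter_upwards [h.hasPalm.ae_of_ae_palm (measure_eq_zero_iff_ae_notMem.1 hL0)]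
      with ξ hξ x hx hc
    rw [ae_iff] at hξ
    refine hx (measure_mono_null (singleton_subset_iff.2 ?_) hξ)
    simpa [L] using hc

/-- Under the Palm measure the configuration is almost surely determined by its gaps, which are
regular. -/
theorem IsStationaryUnit.ae_good {P : Measure (Config ℝ)} (h : IsStationaryUnit P) :
    ∀ᵐ ξ ∂palmLine P, ξ.1 ∈ lineModel.good := by
  have hs : ∀ᵐ ξ ∂palmLine P, ∀ x : ℝ, ξ.1 {x} = 0 ∨ ξ.1 {x} = 1 :=
    h.hasPalm.ae_palm_of_ae (fun x ξ hξ y => by rw [shift_singleton]; exact hξ _) h.simple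
  filter_upwards [hs, h.hasPalm.ae_zero_mem,
    h.ae_ne_zero (D := Ioi 0) measurableSet_Ioi (fun z hz => by
      rcases lt_or_gt_of_ne hz with h | h <;> simp [h]),
    h.ae_ne_zero (D := Iio 0) measurableSet_Iio (fun z hz => by
      rcases lt_or_gt_of_ne hz with h | h <;> simp [h])] with ξ h1 h2 h3 h4
  obtain ⟨t, ht, ht0, hξ, hge, hle⟩ := ξ.2.exists_strictMono_comb h1 h2
    (fun x hx => by simpa [shift_apply, preimage, Ioi] using h3 x hx)
    (fun x hx => by simpa [shift_apply, preimage, Iio] using h4 x hx)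
  let s : GapSeq := fun i => (t i - t (i - 1)).toNNReal
  have hts : t = psum s := by
    refine eq_psum ht0 fun i => ?_
    have : t i < t (i + 1) := ht (by omega)
    simp only [s, add_sub_cancel_right]
    rw [Real.coe_toNNReal _ (by linarith)]
    ring
  refine ⟨s, ⟨fun i => ?_, ?_, ?_⟩, ?_⟩
  · exact Real.toNNReal_pos.2 (sub_pos.2 (ht (by omega)))
  · rwa [← hts]
  · rwa [← hts]
  · rw [hξ, hts]
    rfl

theorem IsStationaryUnit.gapLaw_eq {P : Measure (Config ℝ)} (h : IsStationaryUnit P) :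
    gapLaw P = (palmLine P).map fun ξ => lineModel.gaps ξ.1 :=
  Measure.map_congr (h.ae_good.mono fun _ hξ => sq_eq_gaps hξ)

theorem measurable_gaps_val :
    Measurable fun ξ : Config ℝ => lineModel.gaps ξ.1 :=
  lineModel.measurable_gaps.comp measurable_subtype_coe

theorem IsStationaryUnit.isProbabilityMeasure_gapLaw {P : Measure (Config ℝ)}
    (h : IsStationaryUnit P) : IsProbabilityMeasure (gapLaw P) := by
  have := h.isProbabilityMeasure_palmLine
  rw [h.gapLaw_eq]
  exact Measure.isProbabilityMeasure_map measurable_gaps_val.aemeasurable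

theorem IsStationaryUnit.ae_gapLaw {P : Measure (Config ℝ)} (h : IsStationaryUnit P) :
    ∀ᵐ s ∂gapLaw P, s ∈ regularGaps := by
  rw [h.gapLaw_eq]
  refine (ae_map_iff (p := (· ∈ regularGaps)) measurable_gaps_val.aemeasurable
    measurableSet_regularGaps).2 ?_
  exact h.ae_good.mono fun _ hξ => lineModel.gaps_mem hξ

theorem IsStationaryUnit.map_seqShift_gapLaw {P : Measure (Config ℝ)} (h : IsStationaryUnit P)
    (k : ℤ) : (gapLaw P).map (seqShift k) = gapLaw P := by
  rw [h.gapLaw_eq]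
  exact lineModel.map_σ_map_gaps h.hasPalm.isPointStationary h.ae_good k

/-! ### Monotone couplings -/

theorem measurable_proj₀ : Measurable proj₀ :=
  (Measure.measurable_map _ measurable_fst).comp measurable_subtype_coe

theorem measurable_proj₁ : Measurable proj₁ :=
  (Measure.measurable_map _ measurable_snd).comp measurable_subtype_coe

theorem proj₀_apply (ξ : Config (ℝ × ℝ)) {A : Set ℝ} (hA : MeasurableSet A) :
    proj₀ ξ A = ξ.1 (Prod.fst ⁻¹' A) :=
  Measure.map_apply measurable_fst hA

theorem proj₁_apply (ξ : Config (ℝ × ℝ)) {A : Set ℝ} (hA : MeasurableSet A) :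
    proj₁ ξ A = ξ.1 (Prod.snd ⁻¹' A) :=
  Measure.map_apply measurable_snd hA

theorem MonotoneConfig.shift {ξ : Config (ℝ × ℝ)} (h : MonotoneConfig ξ) (z : ℝ × ℝ) :
    MonotoneConfig (shift z ξ) := by
  intro p q hp hq hpq
  rw [shift_singleton] at hp hq
  simpa using h _ _ hp hq (by simpa using hpq)

/-- The points of `ξ` define a permutation `φ` of the integers: the point of `ξ` above the point
number `i` of the first projection projects to the point number `φ i` of the second one. By
monotonicity `φ` is a translation, and it fixes `0` as the origin is a point of `ξ`. -/
theorem MonotoneConfig.eq_comb {ξ : Config (ℝ × ℝ)} (hm : MonotoneConfig ξ) (h0 : ξ.1 {0} ≠ 0)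
    {a b : ℤ → ℝ} (ha : StrictMono a) (hb : StrictMono b) (ha0 : a 0 = 0) (hb0 : b 0 = 0)
    (h₀ : proj₀ ξ = comb a) (h₁ : proj₁ ξ = comb b) : ξ.1 = comb fun i => (a i, b i) := by
  have hfst : ∀ x, ξ.1 (Prod.fst ⁻¹' {x}) = comb a {x} := fun x => by
    rw [← h₀, proj₀_apply _ (measurableSet_singleton x)]
  have hsnd : ∀ y, ξ.1 (Prod.snd ⁻¹' {y}) = comb b {y} := fun y => by
    rw [← h₁, proj₁_apply _ (measurableSet_singleton y)]
  have hatom : ∀ p, ξ.1 {p} ≠ 0 → (∃ i, a i = p.1) ∧ ∃ j, b j = p.2 := fun p hp => by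
    rw [← comb_singleton_ne_zero_iff, ← comb_singleton_ne_zero_iff, ← hfst, ← hsnd]
    exact ⟨fun h => hp (measure_mono_null (by simp) h),
      fun h => hp (measure_mono_null (by simp) h)⟩
  have huniq : ∀ p q : ℝ × ℝ, ξ.1 {p} ≠ 0 → ξ.1 {q} ≠ 0 → p.1 = q.1 → p.2 = q.2 :=
    fun p q hp hq hpq => le_antisymm (hm p q hp hq hpq.le) (hm q p hq hp hpq.ge)
  have hone : ∀ p, ξ.1 {p} ≠ 0 → ξ.1 {p} = 1 := fun p hp => by
    obtain ⟨i, hi⟩ := (hatom p hp).1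
    have hle : ξ.1 {p} ≤ 1 := by
      rw [← comb_singleton_of_injective ha.injective i, hi, ← hfst]
      exact measure_mono (by simp)
    obtain ⟨n, hn⟩ := ξ.2 {p} (measurableSet_singleton p) Bornology.isBounded_singleton
    rw [hn] at hle hp ⊢
    have h1 : n ≤ 1 := by exact_mod_cast hle
    have h2 : n ≠ 0 := by exact_mod_cast hp
    have h3 : n = 1 := by omega
    rw [h3, Nat.cast_one]
  have hex : ∀ i, ∃ j, ξ.1 {(a i, b j)} ≠ 0 := fun i => by
    have h1 : ξ.1 (Prod.fst ⁻¹' {a i}) ≠ 0 := by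
      rw [hfst, comb_singleton_of_injective ha.injective]
      exact one_ne_zero
    obtain ⟨p, hp, hp'⟩ := ξ.2.exists_atom h1
    obtain ⟨j, hj⟩ := (hatom p hp').2
    refine ⟨j, ?_⟩
    rwa [hj, show a i = p.1 from hp.symm]
  choose φ hφ using hex
  have hmono : Monotone φ := fun i j hij =>
    hb.le_iff_le.1 (hm _ _ (hφ i) (hφ j) (ha.monotone hij))
  have hinj : Function.Injective φ := fun i j hij => by
    by_contra hne
    have hne' : (a i, b (φ i)) ≠ (a j, b (φ j)) := fun h =>
      hne (ha.injective (congrArg Prod.fst h))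
    have h2 : ξ.1 ({(a i, b (φ i))} ∪ {(a j, b (φ j))}) ≤ 1 := by
      rw [← comb_singleton_of_injective hb.injective (φ i), ← hsnd]
      refine measure_mono ?_
      rintro p (rfl | rfl)
      · simp
      · simp [hij]
    rw [measure_union (by simpa using hne') (measurableSet_singleton _), hone _ (hφ i),
      hone _ (hφ j)] at h2
    norm_num at h2
  have hsurj : Function.Surjective φ := fun j => by
    have h1 : ξ.1 (Prod.snd ⁻¹' {b j}) ≠ 0 := by
      rw [hsnd, comb_singleton_of_injective hb.injective]
      exact one_ne_zero
    obtain ⟨p, hp, hp'⟩ := ξ.2.exists_atom h1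
    obtain ⟨i, hi⟩ := (hatom p hp').1
    refine ⟨i, hb.injective ?_⟩
    rw [show b j = p.2 from hp.symm]
    exact huniq _ _ (hφ i) hp' hi
  have hφ0 : φ 0 = 0 := hb.injective (by
    rw [hb0]
    exact huniq (a 0, b (φ 0)) 0 (hφ 0) h0 ha0)
  have hid : ∀ i, φ i = i := fun i => by
    rw [int_eq_add_of_monotone_of_bijective hmono ⟨hinj, hsurj⟩ i, hφ0, add_zero]
  simp only [hid] at hφ
  refine ξ.2.eq_comb (fun i j hij => ha.injective (congrArg Prod.fst hij))
    (fun i => hone _ (hφ i)) fun p hp => ?_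
  obtain ⟨i, hi⟩ := (hatom p hp).1
  exact ⟨i, Prod.ext hi (huniq _ _ (hφ i) hp hi)⟩

theorem monotoneConfig_config {u : GapSeq × GapSeq} (hu : u ∈ planeModel.T) :
    MonotoneConfig (planeModel.config u) := by
  intro p q hp hq hpq
  rw [planeModel.config_val hu, comb_singleton_ne_zero_iff] at hp hq
  obtain ⟨i, rfl⟩ := hp
  obtain ⟨j, rfl⟩ := hq
  exact (strictMono_psum hu.2).monotone ((strictMono_psum hu.1).le_iff_le.1 hpq)

theorem proj₀_config {u : GapSeq × GapSeq} (hu : u ∈ planeModel.T) :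
    proj₀ (planeModel.config u) = comb (psum u.1) := by
  rw [proj₀, planeModel.config_val hu, map_comb measurable_fst]
  rfl

theorem proj₁_config {u : GapSeq × GapSeq} (hu : u ∈ planeModel.T) :
    proj₁ (planeModel.config u) = comb (psum u.2) := by
  rw [proj₁, planeModel.config_val hu, map_comb measurable_snd]
  rfl

theorem sq_proj_config {u : GapSeq × GapSeq} (hu : u ∈ planeModel.T) :
    (sq (proj₀ (planeModel.config u)), sq (proj₁ (planeModel.config u))) = u := by
  rw [proj₀_config hu, proj₁_config hu, sq_comb_psum hu.1, sq_comb_psum hu.2]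

theorem volume_window_prod : volume (window ×ˢ window) = 1 := by
  rw [Measure.volume_eq_prod, Measure.prod_prod, volume_window, one_mul]

namespace IsMonotoneCoupling

variable {P₀ P₁ : Measure (Config ℝ)} {Q : Measure (Config (ℝ × ℝ))}

theorem hasPalm (h : IsMonotoneCoupling P₀ P₁ Q) : HasPalm Q (palmPlane Q) := by
  have := h.sigmaFinite
  have := h.palm_prob
  have : IsFiniteMeasure (palm (window ×ˢ window)
      (measurableSet_window.prod measurableSet_window) Q) :=
    inferInstanceAs (IsFiniteMeasure (palmPlane Q))
  refine hasPalm_palm h.stationary (measurableSet_window.prod measurableSet_window) ?_ ?_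
  · rw [interior_prod_eq, window, interior_Icc]
    exact ⟨0, by norm_num⟩
  · rw [volume_window_prod]
    exact ENNReal.one_ne_top

theorem ae_proj₀_mem (h : IsMonotoneCoupling P₀ P₁ Q) (h₀ : IsStationaryUnit P₀) :
    ∀ᵐ ξ ∂palmPlane Q, proj₀ ξ ∈ lineModel.good := by
  have h1 : ∀ᵐ μ ∂((palmPlane Q).map proj₀), μ ∈ lineModel.good := by
    rw [h.palm_fst]
    exact (ae_map_iff (p := (· ∈ lineModel.good)) measurable_subtype_coe.aemeasurable
      lineModel.measurableSet_good).2 h₀.ae_good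
  exact ae_of_ae_map measurable_proj₀.aemeasurable h1

theorem ae_proj₁_mem (h : IsMonotoneCoupling P₀ P₁ Q) (h₁ : IsStationaryUnit P₁) :
    ∀ᵐ ξ ∂palmPlane Q, proj₁ ξ ∈ lineModel.good := by
  have h1 : ∀ᵐ μ ∂((palmPlane Q).map proj₁), μ ∈ lineModel.good := by
    rw [h.palm_snd]
    exact (ae_map_iff (p := (· ∈ lineModel.good)) measurable_subtype_coe.aemeasurable
      lineModel.measurableSet_good).2 h₁.ae_good
  exact ae_of_ae_map measurable_proj₁.aemeasurable h1

/-- Under the Palm measure of a monotone coupling the configuration is almost surely determined by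
the regular gaps of its two projections. -/
theorem ae_good (h : IsMonotoneCoupling P₀ P₁ Q) (h₀ : IsStationaryUnit P₀)
    (h₁ : IsStationaryUnit P₁) : ∀ᵐ ξ ∂palmPlane Q, ξ.1 ∈ planeModel.good := by
  filter_upwards [h.ae_proj₀_mem h₀, h.ae_proj₁_mem h₁, h.hasPalm.ae_zero_mem,
    h.hasPalm.ae_palm_of_ae (fun z _ hξ => hξ.shift z) h.monotone] with ξ hξ₀ hξ₁ hz hm
  obtain ⟨s, hs, hs'⟩ := hξ₀
  obtain ⟨s₁, hs₁, hs₁'⟩ := hξ₁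
  exact ⟨(s, s₁), ⟨hs, hs₁⟩, (hm.eq_comb hz (strictMono_psum hs) (strictMono_psum hs₁)
    (psum_zero s) (psum_zero s₁) hs'.symm hs₁'.symm).symm⟩

theorem iota_eq (h : IsMonotoneCoupling P₀ P₁ Q) (h₀ : IsStationaryUnit P₀)
    (h₁ : IsStationaryUnit P₁) : iota Q = (palmPlane Q).map fun ξ => planeModel.gaps ξ.1 := by
  refine Measure.map_congr ?_
  filter_upwards [h.ae_good h₀ h₁] with ξ hξ
  conv_lhs => rw [← planeModel.config_gaps hξ]
  exact sq_proj_config (planeModel.gaps_mem hξ)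

end IsMonotoneCoupling

theorem measurable_plane_gaps :
    Measurable fun ξ : Config (ℝ × ℝ) => planeModel.gaps ξ.1 :=
  planeModel.measurable_gaps.comp measurable_subtype_coe

variable {P₀ P₁ : Measure (Config ℝ)}

theorem IsStationaryUnit.map_gaps (h₀ : IsStationaryUnit P₀) :
    ((palmLine P₀).map Subtype.val).map lineModel.gaps = gapLaw P₀ := by
  rw [h₀.gapLaw_eq, Measure.map_map lineModel.measurable_gaps measurable_subtype_coe]
  rfl

theorem measurable_comb_psum : Measurable fun s : GapSeq => comb (psum s) :=
  lineModel.measurable_comb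

theorem IsStationaryUnit.map_comb_gapLaw (h₀ : IsStationaryUnit P₀) :
    (gapLaw P₀).map (fun s => comb (psum s)) = (palmLine P₀).map Subtype.val := by
  rw [h₀.gapLaw_eq, Measure.map_map measurable_comb_psum measurable_gaps_val]
  exact Measure.map_congr (h₀.ae_good.mono fun _ hξ => lineModel.comb_gaps hξ)

theorem iota_mapsTo (h₀ : IsStationaryUnit P₀) (h₁ : IsStationaryUnit P₁) :
    MapsTo iota (monotoneCouplings P₀ P₁) (gapCouplings (gapLaw P₀) (gapLaw P₁)) := by
  intro Q hQ
  have h : IsMonotoneCoupling P₀ P₁ Q := hQ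
  have hg := h.ae_good h₀ h₁
  have := h.palm_prob
  have e := h.iota_eq h₀ h₁
  have hpair : ∀ᵐ ξ ∂palmPlane Q, planeModel.gaps ξ.1 =
      (lineModel.gaps (proj₀ ξ), lineModel.gaps (proj₁ ξ)) := by
    filter_upwards [hg] with ξ hξ
    have hu := planeModel.gaps_mem hξ
    conv_rhs => rw [← planeModel.config_gaps hξ]
    rw [proj₀_config hu, proj₁_config hu]
    exact Prod.ext (lineModel.gaps_comb hu.1).symm (lineModel.gaps_comb hu.2).symm
  refine ⟨?_, ?_, ?_, fun k => ?_⟩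
  · rw [e]
    exact Measure.isProbabilityMeasure_map measurable_plane_gaps.aemeasurable
  · rw [e, Measure.map_map measurable_fst measurable_plane_gaps, ← h₀.map_gaps, ← h.palm_fst,
      Measure.map_map lineModel.measurable_gaps measurable_proj₀]
    exact Measure.map_congr (hpair.mono fun ξ hξ => congrArg Prod.fst hξ)
  · rw [e, Measure.map_map measurable_snd measurable_plane_gaps, ← h₁.map_gaps, ← h.palm_snd,
      Measure.map_map lineModel.measurable_gaps measurable_proj₁]
    exact Measure.map_congr (hpair.mono fun ξ hξ => congrArg Prod.snd hξ)
  · rw [e]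
    exact planeModel.map_σ_map_gaps h.hasPalm.isPointStationary hg k

/-- The gaps determine the Palm measure, and the Palm measure determines the coupling. -/
theorem iota_injOn (h₀ : IsStationaryUnit P₀) (h₁ : IsStationaryUnit P₁) :
    InjOn iota (monotoneCouplings P₀ P₁) := by
  intro Q hQ Q' hQ' he
  have h : IsMonotoneCoupling P₀ P₁ Q := hQ
  have h' : IsMonotoneCoupling P₀ P₁ Q' := hQ'
  have hV : palmPlane Q = palmPlane Q' := by
    rw [← planeModel.map_config_map_gaps (h.ae_good h₀ h₁), ← h.iota_eq h₀ h₁, he,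
      h'.iota_eq h₀ h₁, planeModel.map_config_map_gaps (h'.ae_good h₀ h₁)]
  exact planeModel.hasPalm_unique h.hasPalm (hV ▸ h'.hasPalm) (h.ae_good h₀ h₁) h.nonempty
    h'.nonempty

theorem IsGapCoupling.ae_mem (h₀ : IsStationaryUnit P₀) (h₁ : IsStationaryUnit P₁)
    {U : Measure (GapSeq × GapSeq)} (hU : IsGapCoupling (gapLaw P₀) (gapLaw P₁) U) :
    ∀ᵐ u ∂U, u ∈ planeModel.T := by
  have e₀ : ∀ᵐ s ∂(U.map Prod.fst), s ∈ regularGaps := hU.fst ▸ h₀.ae_gapLaw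
  have e₁ : ∀ᵐ s ∂(U.map Prod.snd), s ∈ regularGaps := hU.snd ▸ h₁.ae_gapLaw
  filter_upwards [ae_of_ae_map measurable_fst.aemeasurable e₀,
    ae_of_ae_map measurable_snd.aemeasurable e₁] with u hu₀ hu₁
  exact ⟨hu₀, hu₁⟩

/-- A stationary coupling of the gaps is turned into a law of configurations in the plane that are
rooted at the origin; inverting the Palm measure yields the stationary monotone coupling. -/
theorem iota_surjOn (h₀ : IsStationaryUnit P₀) (h₁ : IsStationaryUnit P₁) :
    SurjOn iota (monotoneCouplings P₀ P₁) (gapCouplings (gapLaw P₀) (gapLaw P₁)) := by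
  intro U hU'
  have hU : IsGapCoupling (gapLaw P₀) (gapLaw P₁) U := hU'
  have := hU.prob
  have hT := hU.ae_mem h₀ h₁
  obtain ⟨Q, hQσ, hQs, hQ0, hQV⟩ := planeModel.exists_hasPalm hT hU.stationary
  have hpalm : palmPlane Q = U.map planeModel.config :=
    hQV.palm_eq (measurableSet_window.prod measurableSet_window) volume_window_prod
  have hQ : IsMonotoneCoupling P₀ P₁ Q := by
    refine ⟨hQσ, hQs, hQ0, ?_, ?_, ?_, ?_⟩
    · rw [hpalm]
      exact Measure.isProbabilityMeasure_map planeModel.measurable_config.aemeasurable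
    · rw [hpalm, Measure.map_map measurable_proj₀ planeModel.measurable_config,
        ← h₀.map_comb_gapLaw, ← hU.fst, Measure.map_map measurable_comb_psum measurable_fst]
      exact Measure.map_congr (hT.mono fun u hu => proj₀_config hu)
    · rw [hpalm, Measure.map_map measurable_proj₁ planeModel.measurable_config,
        ← h₁.map_comb_gapLaw, ← hU.snd, Measure.map_map measurable_comb_psum measurable_snd]
      exact Measure.map_congr (hT.mono fun u hu => proj₁_config hu)
    · refine hQV.ae_of_ae_palm_of_ne_zero (fun z _ hξ => hξ.shift z) ?_ hQ0
      filter_upwards [planeModel.ae_map_config hT] with ξ hξ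
      rw [← planeModel.config_gaps hξ]
      exact monotoneConfig_config (planeModel.gaps_mem hξ)
  exact ⟨Q, hQ, by rw [hQ.iota_eq h₀ h₁, hpalm, planeModel.map_gaps_map_config hT]⟩

theorem iota_bijOn (h₀ : IsStationaryUnit P₀) (h₁ : IsStationaryUnit P₁) :
    BijOn iota (monotoneCouplings P₀ P₁) (gapCouplings (gapLaw P₀) (gapLaw P₁)) :=
  ⟨iota_mapsTo h₀ h₁, iota_injOn h₀ h₁, iota_surjOn h₀ h₁⟩

/-! ### The cost of a monotone coupling -/

theorem tauBar_shift_neg_config {u : GapSeq × GapSeq} (hu : u ∈ planeModel.T) {z : ℝ × ℝ}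
    (h0 : z.1 ≤ 0) (h1 : 0 < psum u.1 1 + z.1) :
    tauBar (shift (-z) (planeModel.config u)).1 = fun i => planeModel.pts u i + z := by
  rw [planeModel.shift_neg_config_val hu]
  exact planeModel.numbering_eq hu h0 h1

/-- The cost is the sum over the points `x` in the window of a function of `θ_x ξ`, so the Campbell
formula applies. -/
theorem cost_eq_gapCost (h₀ : IsStationaryUnit P₀) (h₁ : IsStationaryUnit P₁) (p : ℝ)
    {Q : Measure (Config (ℝ × ℝ))} (h : IsMonotoneCoupling P₀ P₁ Q) :
    cost p Q = gapCost p (iota Q) := by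
  classical
  let c : GapSeq × GapSeq → ℝ≥0∞ := fun u => ENNReal.ofReal (|(u.1 1 : ℝ) - (u.2 1 : ℝ)| ^ p)
  have hc : Measurable c := by
    unfold c
    fun_prop
  let B : Set (ℝ × ℝ) := window ×ˢ window
  have hB : MeasurableSet B := measurableSet_window.prod measurableSet_window
  have h1B : Measurable (B.indicator (1 : ℝ × ℝ → ℝ≥0∞)) := measurable_one.indicator hB
  have hcg : Measurable fun ξ : Config (ℝ × ℝ) => c (planeModel.gaps ξ.1) :=
    hc.comp measurable_plane_gaps
  have e1 : cost p Q =
      ∫⁻ ξ, ∫⁻ x, B.indicator 1 x * c (planeModel.gaps (shift x ξ).1) ∂ξ.1 ∂Q := by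
    refine lintegral_congr_ae ?_
    filter_upwards [planeModel.ae_exists_eq_shift_config h.hasPalm (h.ae_good h₀ h₁) h.nonempty]
      with ξ hξ
    obtain ⟨u, hu, z, hz0, hz1, rfl⟩ := hξ
    rw [tauBar_shift_neg_config hu hz0 hz1, lintegral_shift, planeModel.lintegral_config hu]
    refine tsum_congr fun l => ?_
    have hg : planeModel.gaps (shift (planeModel.pts u l - -z)
        (shift (-z) (planeModel.config u))).1 = planeModel.σ l u := by
      rw [shift_shift, sub_add_cancel, planeModel.shift_config hu,
        planeModel.gaps_config (planeModel.σ_mem l u hu)]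
    rw [hg, sub_neg_eq_add]
    -- The gap after the point number `l` is the gap number one of the sequence shifted by `l`.
    have hgap : ∀ s : GapSeq, ∀ w : ℝ, psum s (l + 1) + w - (psum s l + w) = seqShift l s 1 := by
      intro s w
      rw [psum_succ, seqShift, add_comm 1 l]
      ring
    have hcost : ENNReal.ofReal (|((planeModel.pts u (l + 1) + z).1 - (planeModel.pts u l + z).1)
        - ((planeModel.pts u (l + 1) + z).2 - (planeModel.pts u l + z).2)| ^ p) =
        c (planeModel.σ l u) := by
      change ENNReal.ofReal (|(psum u.1 (l + 1) + z.1 - (psum u.1 l + z.1)) -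
        (psum u.2 (l + 1) + z.2 - (psum u.2 l + z.2))| ^ p) = _
      rw [hgap, hgap]
      rfl
    by_cases hl : planeModel.pts u l + z ∈ B
    · rw [if_pos hl, indicator_of_mem hl, Pi.one_apply, one_mul, hcost]
    · rw [if_neg hl, indicator_of_notMem hl, zero_mul]
  rw [e1, h.hasPalm (fun q => B.indicator 1 q.2 * c (planeModel.gaps q.1.1))
    ((h1B.comp measurable_snd).mul (hcg.comp measurable_fst)), gapCost, h.iota_eq h₀ h₁,
    lintegral_map hc measurable_plane_gaps]
  refine lintegral_congr fun ξ => ?_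
  simp only
  rw [lintegral_mul_const _ h1B, lintegral_indicator_one hB, volume_window_prod, one_mul]

/-! ### Existence of an optimal coupling of the gap distributions -/

/-- The independent coupling is stationary. -/
theorem gapCouplings_nonempty (h₀ : IsStationaryUnit P₀) (h₁ : IsStationaryUnit P₁) :
    (gapCouplings (gapLaw P₀) (gapLaw P₁)).Nonempty := by
  have := h₀.isProbabilityMeasure_gapLaw
  have := h₁.isProbabilityMeasure_gapLaw
  refine ⟨(gapLaw P₀).prod (gapLaw P₁), inferInstance, ?_, ?_, fun k => ?_⟩
  · simp
  · simp
  · rw [← Measure.map_prod_map _ _ (measurable_seqShift k) (measurable_seqShift k),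
      h₀.map_seqShift_gapLaw, h₁.map_seqShift_gapLaw]

theorem continuous_seqShift (k : ℤ) : Continuous (seqShift k) :=
  continuous_pi fun i => continuous_apply (i + k)

/-- The couplings of `G₀` and `G₁` are tight, as their marginals are fixed. -/
theorem isTightMeasureSet_gapCouplings (G₀ G₁ : Measure GapSeq) [IsProbabilityMeasure G₀]
    [IsProbabilityMeasure G₁] : IsTightMeasureSet (gapCouplings G₀ G₁) := by
  rw [isTightMeasureSet_iff_exists_isCompact_measure_compl_le]
  intro ε hε
  have hε2 : 0 < ε / 2 := ENNReal.half_pos hε.ne'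
  obtain ⟨K₀, hK₀, h₀⟩ := isTightMeasureSet_iff_exists_isCompact_measure_compl_le.1
    (isTightMeasureSet_singleton (μ := G₀)) (ε / 2) hε2
  obtain ⟨K₁, hK₁, h₁⟩ := isTightMeasureSet_iff_exists_isCompact_measure_compl_le.1
    (isTightMeasureSet_singleton (μ := G₁)) (ε / 2) hε2
  refine ⟨K₀ ×ˢ K₁, hK₀.prod hK₁, fun U hU => ?_⟩
  have hU' : IsGapCoupling G₀ G₁ U := hU
  calc U (K₀ ×ˢ K₁)ᶜ ≤ U (Prod.fst ⁻¹' K₀ᶜ ∪ Prod.snd ⁻¹' K₁ᶜ) := by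
        rw [compl_prod_eq_union]
        refine measure_mono (union_subset_union ?_ ?_) <;> rintro ⟨x, y⟩ <;> simp
    _ ≤ U (Prod.fst ⁻¹' K₀ᶜ) + U (Prod.snd ⁻¹' K₁ᶜ) := measure_union_le _ _
    _ = G₀ K₀ᶜ + G₁ K₁ᶜ := by
        rw [← Measure.map_apply measurable_fst hK₀.measurableSet.compl, hU'.fst,
          ← Measure.map_apply measurable_snd hK₁.measurableSet.compl, hU'.snd]
    _ ≤ ε / 2 + ε / 2 := add_le_add (h₀ G₀ rfl) (h₁ G₁ rfl)
    _ = ε := ENNReal.add_halves ε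

theorem isClosed_gapCouplings (G₀ G₁ : Measure GapSeq) [IsProbabilityMeasure G₀]
    [IsProbabilityMeasure G₁] :
    IsClosed {U : ProbabilityMeasure (GapSeq × GapSeq) |
      (U : Measure (GapSeq × GapSeq)) ∈ gapCouplings G₀ G₁} := by
  have hσ : ∀ k, Continuous (Prod.map (seqShift k) (seqShift k)) := fun k =>
    (continuous_seqShift k).prodMap (continuous_seqShift k)
  have e : {U : ProbabilityMeasure (GapSeq × GapSeq) |
      (U : Measure (GapSeq × GapSeq)) ∈ gapCouplings G₀ G₁} =
      {U | U.map continuous_fst.measurable.aemeasurable = ⟨G₀, inferInstance⟩} ∩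
      ({U | U.map continuous_snd.measurable.aemeasurable = ⟨G₁, inferInstance⟩} ∩
      ⋂ k, {U | U.map (hσ k).measurable.aemeasurable = U}) := by
    ext U
    simp only [mem_inter_iff, mem_iInter, mem_ofPred_eq]
    constructor
    · intro h
      have h' : IsGapCoupling G₀ G₁ U := h
      exact ⟨Subtype.ext h'.fst, Subtype.ext h'.snd, fun k => Subtype.ext (h'.stationary k)⟩
    · rintro ⟨h1, h2, h3⟩
      exact ⟨inferInstance, congrArg Subtype.val h1, congrArg Subtype.val h2,
        fun k => congrArg Subtype.val (h3 k)⟩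
  rw [e]
  exact (isClosed_eq (ProbabilityMeasure.continuous_map continuous_fst) continuous_const).inter
    ((isClosed_eq (ProbabilityMeasure.continuous_map continuous_snd) continuous_const).inter
    (isClosed_iInter fun k => isClosed_eq (ProbabilityMeasure.continuous_map (hσ k))
      continuous_id))

/-- The cost is the supremum of the integrals of the bounded continuous functions
`min n |s_1 - s'_1|^p`. -/
theorem lowerSemicontinuous_gapCost {p : ℝ} (hp : 0 ≤ p) :
    LowerSemicontinuous fun U : ProbabilityMeasure (GapSeq × GapSeq) =>
      gapCost p (U : Measure (GapSeq × GapSeq)) := by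
  let c : GapSeq × GapSeq → ℝ≥0 := fun u => (|(u.1 1 : ℝ) - (u.2 1 : ℝ)| ^ p).toNNReal
  have hc : Continuous c := by
    refine continuous_real_toNNReal.comp (Continuous.rpow_const ?_ fun _ => Or.inr hp)
    fun_prop
  let f : ℕ → BoundedContinuousFunction (GapSeq × GapSeq) ℝ≥0 := fun n =>
    BoundedContinuousFunction.mkOfBound ⟨fun u => min (c u) n, hc.min continuous_const⟩ n
      fun u v => by
        rw [NNReal.dist_eq, abs_sub_le_iff]
        have h1 : ∀ w, ((min (c w) n : ℝ≥0) : ℝ) ≤ n := fun w => by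
          exact_mod_cast min_le_right (c w) (n : ℝ≥0)
        have h2 : ∀ w, (0 : ℝ) ≤ ((min (c w) n : ℝ≥0) : ℝ) := fun w => NNReal.coe_nonneg _
        exact ⟨by have := h1 u; have := h2 v; simp only [ContinuousMap.coe_mk]; linarith,
          by have := h1 v; have := h2 u; simp only [ContinuousMap.coe_mk]; linarith⟩
  have e : (fun U : ProbabilityMeasure (GapSeq × GapSeq) =>
      gapCost p (U : Measure (GapSeq × GapSeq))) =
      fun U : ProbabilityMeasure (GapSeq × GapSeq) =>
        ⨆ n, ∫⁻ u, f n u ∂(U : Measure (GapSeq × GapSeq)) := by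
    funext U
    rw [← lintegral_iSup]
    · refine lintegral_congr fun u => ?_
      change (c u : ℝ≥0∞) = ⨆ n : ℕ, ((min (c u) n : ℝ≥0) : ℝ≥0∞)
      refine le_antisymm ?_ (iSup_le fun n => by exact_mod_cast min_le_left _ _)
      obtain ⟨n, hn⟩ := exists_nat_ge (c u)
      exact le_iSup_of_le n (by rw [min_eq_left hn])
    · exact fun n => ((hc.min continuous_const).measurable).coe_nnreal_ennreal
    · intro m n hmn u
      have : min (c u) (m : ℝ≥0) ≤ min (c u) n := min_le_min le_rfl (by exact_mod_cast hmn)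
      exact ENNReal.coe_le_coe.2 this
  rw [e]
  exact lowerSemicontinuous_iSup fun n =>
    (ProbabilityMeasure.continuous_lintegral_boundedContinuousFunction (f n)).lowerSemicontinuous

/-- The direct method: the stationary couplings form a compact set for weak convergence, by
Prokhorov's theorem, and the cost is lower semicontinuous. -/
theorem exists_gapCost_eq_iInf (G₀ G₁ : Measure GapSeq) [IsProbabilityMeasure G₀]
    [IsProbabilityMeasure G₁] (hne : (gapCouplings G₀ G₁).Nonempty) {p : ℝ} (hp : 0 ≤ p) :
    ∃ U ∈ gapCouplings G₀ G₁, gapCost p U = ⨅ U ∈ gapCouplings G₀ G₁, gapCost p U := by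
  let S : Set (ProbabilityMeasure (GapSeq × GapSeq)) := {U | U.1 ∈ gapCouplings G₀ G₁}
  have hS : IsCompact S := by
    have hcl : closure S = S := (isClosed_gapCouplings G₀ G₁).closure_eq
    rw [← hcl]
    refine isCompact_closure_of_isTightMeasureSet
      ((isTightMeasureSet_gapCouplings G₀ G₁).subset ?_)
    rintro _ ⟨U, hU, rfl⟩
    exact hU
  have hSne : S.Nonempty := by
    obtain ⟨U, hU⟩ := hne
    exact ⟨⟨U, IsGapCoupling.prob hU⟩, hU⟩
  obtain ⟨U, hU, hmin⟩ := ((lowerSemicontinuous_gapCost hp).lowerSemicontinuousOn S).exists_isMinOn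
    hSne hS
  refine ⟨U, hU, le_antisymm (le_iInf₂ fun U' hU' => ?_)
    (iInf₂_le (U : Measure (GapSeq × GapSeq)) hU)⟩
  exact hmin (show (⟨U', IsGapCoupling.prob hU'⟩ : ProbabilityMeasure _) ∈ S from hU')

end PointProcess

end

theorem mainTheorem9
    (P₀ P₁ : MeasureTheory.Measure (PointProcess.Config ℝ))
    (h₀ : PointProcess.IsStationaryUnit P₀) (h₁ : PointProcess.IsStationaryUnit P₁) :
    Set.BijOn PointProcess.iota
      (PointProcess.monotoneCouplings P₀ P₁)
      (PointProcess.gapCouplings (PointProcess.gapLaw P₀) (PointProcess.gapLaw P₁)) ∧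
    ∀ p : ℝ, 1 ≤ p →
      (∀ Q ∈ PointProcess.monotoneCouplings P₀ P₁,
        PointProcess.cost p Q = PointProcess.gapCost p (PointProcess.iota Q)) ∧
      PointProcess.processDist p P₀ P₁ =
        PointProcess.gapDist p (PointProcess.gapLaw P₀) (PointProcess.gapLaw P₁) ∧
      ∃ Q ∈ PointProcess.monotoneCouplings P₀ P₁,
        PointProcess.cost p Q = PointProcess.processDist p P₀ P₁ ^ p := by
  have hbij := PointProcess.iota_bijOn h₀ h₁
  refine ⟨hbij, fun p hp => ?_⟩
  have hcost : ∀ Q ∈ PointProcess.monotoneCouplings P₀ P₁,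
      PointProcess.cost p Q = PointProcess.gapCost p (PointProcess.iota Q) :=
    fun Q hQ => PointProcess.cost_eq_gapCost h₀ h₁ p hQ
  have hinf : ⨅ Q ∈ PointProcess.monotoneCouplings P₀ P₁, PointProcess.cost p Q =
      ⨅ U ∈ PointProcess.gapCouplings (PointProcess.gapLaw P₀) (PointProcess.gapLaw P₁),
        PointProcess.gapCost p U := by
    rw [← hbij.image_eq, iInf_image]
    exact biInf_congr hcost
  refine ⟨hcost, by rw [PointProcess.processDist, PointProcess.gapDist, hinf], ?_⟩
  have := h₀.isProbabilityMeasure_gapLaw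
  have := h₁.isProbabilityMeasure_gapLaw
  obtain ⟨U, hU, hUmin⟩ := PointProcess.exists_gapCost_eq_iInf (PointProcess.gapLaw P₀)
    (PointProcess.gapLaw P₁) (PointProcess.gapCouplings_nonempty h₀ h₁) (zero_le_one.trans hp)
  obtain ⟨Q, hQ, rfl⟩ := hbij.surjOn hU
  refine ⟨Q, hQ, ?_⟩
  rw [hcost Q hQ, hUmin, PointProcess.processDist, hinf, ← ENNReal.rpow_mul, one_div,
    inv_mul_cancel₀ (by linarith), ENNReal.rpow_one]
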